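/- Let $n\ge 2$, let $\mathcal X$ be a measurable space, let $X_1,\dots,X_{n+1}$ be independent and identically distributed random variables with values in $\mathcal X$, and put $\mathbf X=(X_1,\dots,X_{n+1})$. For $f:\mathcal X^n\to\mathbb R$, $1\le k\le n$ and $y,y'\in\mathcal X$ let $$D^k_{y,y'}f(\mathbf x)=f(x_1,\dots,x_{k-1},y,x_{k+1},\dots,x_n)-f(x_1,\dots,x_{k-1},y',x_{k+1},\dots,x_n),$$ $$M(f)=\max_k\sup_{\mathbf x,y,y'}D^k_{y,y'}f(\mathbf x),\qquad J(f)=n\max_{l\ne k}\ \sup_{\mathbf x,z,z',y,y'}D^l_{z,z'}D^k_{y,y'}f(\mathbf x).$$ The function $f$ has $(a,b)$-weak interactions if $M(f)\le a/n$ and $J(f)\le b/n$. For $\mathbf x\in\mathcal X^{n+1}$ let $S^j_-\mathbf x\in\mathcal X^n$ be $\mathbf x$ with its $j$-th component deleted, let $S^i_y\mathbf x$ be $\mathbf x$ with its $i$-th component replaced by $y$, and let $$v_f(\mathbf x)=\frac1{2(n+1)}\sum_{j=1}^{n+1}\sum_{i\ne j}\bigl(f(S^j_-\mathbf x)-f(S^j_-S^i_{x_j}\mathbf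 x)\bigr)^2 .$$ Let $\sigma(f)$ be the standard deviation of $f(X_1,\dots,X_n)$, and let $K_+(a,b)=\sqrt{2a^2+8b^2}$ and $K_-(a,b)=b/2+\sqrt{2a^2+8b^2}$. Let $f:\mathcal X^n\to\mathbb R$ be bounded and measurable with $(a,b)$-weak interactions, and let $\delta\in(0,1)$. Then with probability at least $1-\delta$ $$\sqrt{v_f(\mathbf X)}-\frac{K_-(a,b)}n\sqrt{\ln(2/\delta)}\ \le\ \sigma(f)\ \le\ \sqrt{v_f(\mathbf X)}+\frac{K_+(a,b)}n\sqrt{\ln(2/\delta)} .$$ For one-sided bounds $2/\delta$ can be replaced by $1/\delta$: with probability at least $1-\delta$ $$\sigma(f)\le\sqrt{v_f(\mathbf X)}+\frac{K_+(a,b)}n\sqrt{\ln(1/\delta)},$$ and, if $\delta\le 1/e$, with probability at least $1-\delta$ $$\sqrt{v_f(\mathbf X)}-\frac{K_-(a,b)}n\sqrt{\ln(1/\delta)}\le\sigma(f).$$ -/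

import Mathlib

open MeasureTheory ProbabilityTheory

namespace WeakInteractions

variable {S : Type*} {n : ℕ}

/-- The partial difference operator `D^k_{y,y'}` on functions of `n` variables. -/
def partialDiff (k : Fin n) (y y' : S) (f : (Fin n → S) → ℝ) (x : Fin n → S) : ℝ :=
  f (Function.update x k y) - f (Function.update x k y')

/-- The algebra `𝒜ₙ` of bounded measurable functions of `n` variables. -/
def IsBoundedMeasurable [MeasurableSpace S] (f : (Fin n → S) → ℝ) : Prop :=
  Measurable f ∧ ∃ C : ℝ, ∀ x, |f x| ≤ C

/-- The seminorm `M f`, the supremum of all first partial differences. For bounded `f`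
the set of values is bounded, so that this is the true supremum. -/
noncomputable def seminormM (f : (Fin n → S) → ℝ) : ℝ :=
  ⨆ p : Fin n × (Fin n → S) × S × S, partialDiff p.1 p.2.2.1 p.2.2.2 f p.2.1

/-- The seminorm `J f`, equal to `n` times the supremum of all second partial differences
in two distinct coordinates `l ≠ k`. For bounded `f` this is the true supremum. -/
noncomputable def seminormJ (f : (Fin n → S) → ℝ) : ℝ :=
  (n : ℝ) *
    ⨆ p : {lk : Fin n × Fin n // lk.1 ≠ lk.2} × (Fin n → S) × (S × S) × (S × S),
      partialDiff p.1.1.1 p.2.2.1.1 p.2.2.1.2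
        (partialDiff p.1.1.2 p.2.2.2.1 p.2.2.2.2 f) p.2.1

/-- `f` has `(a, b)`-weak interactions. -/
def HasWeakInteractions (a b : ℝ) (f : (Fin n → S) → ℝ) : Prop :=
  seminormM f ≤ a / n ∧ seminormJ f ≤ b / n

/-- The variance estimator `v_f`, a function of `n + 1` variables: `Function.update x i (x j)`
replaces the `i`-th component by the `j`-th one, and `Fin.removeNth j` deletes the
`j`-th component. -/
noncomputable def varEstimator (f : (Fin n → S) → ℝ) (x : Fin (n + 1) → S) : ℝ :=
  1 / (2 * ((n : ℝ) + 1)) *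
    ∑ j : Fin (n + 1), ∑ i ∈ Finset.univ.filter (fun i : Fin (n + 1) => i ≠ j),
      (f (Fin.removeNth j x) - f (Fin.removeNth j (Function.update x i (x j)))) ^ 2

/-- The constant `K₊(a, b)`. -/
noncomputable def Kplus (a b : ℝ) : ℝ := √(2 * a ^ 2 + 8 * b ^ 2)

/-- The constant `K₋(a, b)`. -/
noncomputable def Kminus (a b : ℝ) : ℝ := b / 2 + √(2 * a ^ 2 + 8 * b ^ 2)

/-- The standard deviation `σ(f)` of `f(X₁, …, Xₙ)`, for a sample `X₁, …, Xₙ₊₁`. -/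
noncomputable def stdDev {Ω : Type*} [MeasurableSpace Ω] (P : Measure Ω)
    (X : Fin (n + 1) → Ω → S) (f : (Fin n → S) → ℝ) : ℝ :=
  √(variance (fun ω => f (fun i : Fin n => X i.castSucc ω)) P)

end WeakInteractions

/-! Write `E_k` for averaging over coordinate `k`, and `v` for the estimator. Two facts are
combined: `√v` concentrates around `u = √(E v)` with sub-Gaussian tails, and `u` is close to `σ(f)`.

Bias. Deleting `x_j` leaves an `n`-sample for which `x_j` is an independent copy of any coordinate,
so `E v = ∑ k, E (f - E_k f)²` (`integral_varEstimator`). This is the Efron-Stein bound, hence `σ ≤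
u`. Conversely, the Efron-Stein deficit is controlled by second differences
(`sum_integral_sub_avg_sq_le`), which gives `u² ≤ σ² + b² / (8 n²)` (`integral_varEstimator_le`).
The upper bound on `σ` therefore has no bias term, while the lower bound pays the extra `b / 2` in
`Kminus`.

Concentration. Changing coordinate `k` decreases `v` by at most some `D_k`. These satisfy `D_k ≤ m`
and `∑ k, D_k² ≤ c v` with `m = a (a + b) / (n (n + 1))` and `c = 2 (a + b)² / (n (n + 1))`
(`varEstimator_sub_le`, `sum_pairSum_sq_le`); so `v` is weakly self-bounding. Subadditivity of
entropy (`entropy_avg_le`) turns this into a differential inequality for the cumulant generating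
function, solved by Herbst's method for each sign of the exponent (`mgf_le_of_selfBounding`,
`mgf_neg_le_of_selfBounding`). The resulting moment bounds have exactly the form for which
Chernoff's method yields `exp (-t² / κ)` for deviations of `√v` from `u`, whatever `u` is. The
negative exponents determine the constant: `κ = 4 c - 16 m + 20 m² / c = (2 a² + 8 b²) / (n (n +
1))`. -/

namespace WeakInteractions

/-! ### Partial averages under a product measure -/

section Averaging

variable {S : Type*} [MeasurableSpace S] {n : ℕ}

namespace IsBoundedMeasurable

variable {f g : (Fin n → S) → ℝ}

lemma of_mem_Icc {lo hi : ℝ} (hf : Measurable f) (h : ∀ x, f x ∈ Set.Icc lo hi) :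
    IsBoundedMeasurable f :=
  ⟨hf, max |lo| |hi|, fun x => abs_le_max_abs_abs (h x).1 (h x).2⟩

lemma const (c : ℝ) : IsBoundedMeasurable (fun _ : Fin n → S => c) :=
  ⟨measurable_const, |c|, fun _ => le_rfl⟩

lemma add (hf : IsBoundedMeasurable f) (hg : IsBoundedMeasurable g) :
    IsBoundedMeasurable (fun x => f x + g x) := by
  obtain ⟨hf, C, hC⟩ := hf
  obtain ⟨hg, D, hD⟩ := hg
  exact ⟨hf.add hg, C + D, fun x => (abs_add_le _ _).trans (add_le_add (hC x) (hD x))⟩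

lemma neg (hf : IsBoundedMeasurable f) : IsBoundedMeasurable (fun x => - f x) := by
  obtain ⟨hf, C, hC⟩ := hf
  exact ⟨hf.neg, C, fun x => by rw [abs_neg]; exact hC x⟩

lemma sub (hf : IsBoundedMeasurable f) (hg : IsBoundedMeasurable g) :
    IsBoundedMeasurable (fun x => f x - g x) := by
  simpa [sub_eq_add_neg] using hf.add hg.neg

lemma mul (hf : IsBoundedMeasurable f) (hg : IsBoundedMeasurable g) :
    IsBoundedMeasurable (fun x => f x * g x) := by
  obtain ⟨hf, C, hC⟩ := hf
  obtain ⟨hg, D, hD⟩ := hg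
  refine ⟨hf.mul hg, C * D, fun x => ?_⟩
  rw [abs_mul]
  exact mul_le_mul (hC x) (hD x) (abs_nonneg _) ((abs_nonneg _).trans (hC x))

lemma sq (hf : IsBoundedMeasurable f) : IsBoundedMeasurable (fun x => f x ^ 2) := by
  simpa [pow_two] using hf.mul hf

lemma const_mul (c : ℝ) (hf : IsBoundedMeasurable f) :
    IsBoundedMeasurable (fun x => c * f x) :=
  (IsBoundedMeasurable.const c).mul hf

lemma abs (hf : IsBoundedMeasurable f) : IsBoundedMeasurable (fun x => |f x|) := by
  obtain ⟨hf, C, hC⟩ := hf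
  exact ⟨hf.abs, C, fun x => by rw [abs_abs]; exact hC x⟩

lemma sum {κ : Type*} (s : Finset κ) {F : κ → (Fin n → S) → ℝ}
    (h : ∀ i ∈ s, IsBoundedMeasurable (F i)) :
    IsBoundedMeasurable (fun x => ∑ i ∈ s, F i x) := by
  classical
  induction s using Finset.induction_on with
  | empty => simpa using IsBoundedMeasurable.const (n := n) (S := S) 0
  | insert i s hi ih =>
    simp only [Finset.sum_insert hi]
    exact (h i (by simp)).add (ih fun j hj => h j (by simp [hj]))

lemma comp_continuous {φ : ℝ → ℝ} (hφ : Continuous φ) (hf : IsBoundedMeasurable f) :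
    IsBoundedMeasurable (fun x => φ (f x)) := by
  obtain ⟨hf, C, hC⟩ := hf
  obtain ⟨D, hD⟩ := (isCompact_Icc (a := -C) (b := C)).exists_bound_of_continuousOn
    hφ.continuousOn
  exact ⟨hφ.measurable.comp hf, D, fun x => hD _ (abs_le.1 (hC x))⟩

lemma comp {m : ℕ} {e : (Fin m → S) → (Fin n → S)} (hf : IsBoundedMeasurable f)
    (he : Measurable e) : IsBoundedMeasurable (fun x => f (e x)) :=
  ⟨hf.1.comp he, hf.2.imp fun _ h _ => h _⟩

lemma integrable_comp {Ω : Type*} [MeasurableSpace Ω] {P : Measure Ω} [IsFiniteMeasure P]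
    (hf : IsBoundedMeasurable f) {X : Ω → Fin n → S} (hX : Measurable X) :
    Integrable (fun ω => f (X ω)) P := by
  obtain ⟨hf, C, hC⟩ := hf
  exact Integrable.of_bound (hf.comp hX).aestronglyMeasurable C
    (Filter.Eventually.of_forall fun _ => hC _)

lemma integrable {P : Measure (Fin n → S)} [IsFiniteMeasure P]
    (hf : IsBoundedMeasurable f) : Integrable f P :=
  hf.integrable_comp measurable_id

end IsBoundedMeasurable

/-- The average of `f` over the coordinates in `T`. -/
noncomputable def avg (ν : Measure S) (T : Finset (Fin n)) (f : (Fin n → S) → ℝ)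
    (x : Fin n → S) : ℝ :=
  ∫ x', f (T.piecewise x' x) ∂Measure.pi (fun _ : Fin n => ν)

variable (ν : Measure S) [IsProbabilityMeasure ν]

lemma measurable_piecewise (T : Finset (Fin n)) :
    Measurable (fun p : (Fin n → S) × (Fin n → S) => T.piecewise p.1 p.2) := by
  refine measurable_pi_lambda _ fun i => ?_
  by_cases hi : i ∈ T
  · simp only [Finset.piecewise, hi, if_true]; fun_prop
  · simp only [Finset.piecewise, hi, if_false]; fun_prop

/-- It suffices to test boxes, whose preimage is a product of two boxes, each unrestricted in the
coordinates governed by the other. This is the invariance behind the Fubini arguments for `avg`. -/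
lemma measurePreserving_piecewise (T : Finset (Fin n)) :
    MeasurePreserving (fun p : (Fin n → S) × (Fin n → S) => T.piecewise p.1 p.2)
      ((Measure.pi fun _ : Fin n => ν).prod (Measure.pi fun _ : Fin n => ν))
      (Measure.pi fun _ : Fin n => ν) := by
  refine ⟨measurable_piecewise T, (Measure.pi_eq fun s hs => ?_).symm⟩
  rw [Measure.map_apply (measurable_piecewise T) (MeasurableSet.univ_pi hs)]
  have : (fun p : (Fin n → S) × (Fin n → S) => T.piecewise p.1 p.2) ⁻¹' Set.univ.pi s =
      (Set.univ.pi fun i => if i ∈ T then s i else Set.univ) ×ˢ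
        (Set.univ.pi fun i => if i ∈ T then Set.univ else s i) := by
    ext ⟨x, y⟩
    simp only [Set.mem_preimage, Set.mem_pi, Set.mem_univ, true_imp_iff, Set.mem_prod,
      Finset.piecewise]
    rw [← forall_and]
    refine forall_congr' fun i => ?_
    by_cases hi : i ∈ T <;> simp [hi]
  rw [this, Measure.prod_prod, Measure.pi_pi, Measure.pi_pi, ← Finset.prod_mul_distrib]
  refine Finset.prod_congr rfl fun i _ => ?_
  by_cases hi : i ∈ T <;> simp [hi]

variable {ν} {f g : (Fin n → S) → ℝ}

lemma IsBoundedMeasurable.integrable_piecewise (hf : IsBoundedMeasurable f)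
    (T : Finset (Fin n)) (x : Fin n → S) :
    Integrable (fun x' => f (T.piecewise x' x)) (Measure.pi fun _ : Fin n => ν) :=
  hf.integrable_comp ((measurable_piecewise T).comp (measurable_id.prodMk measurable_const))

lemma avg_mem_Icc (T : Finset (Fin n)) (hf : IsBoundedMeasurable f) {lo hi : ℝ}
    (h : ∀ x, f x ∈ Set.Icc lo hi) (x : Fin n → S) : avg ν T f x ∈ Set.Icc lo hi := by
  have hint := hf.integrable_piecewise (ν := ν) T x
  constructor
  · simpa [avg] using integral_mono (integrable_const lo) hint (fun x' => (h _).1)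
  · simpa [avg] using integral_mono hint (integrable_const hi) (fun x' => (h _).2)

lemma IsBoundedMeasurable.avg (hf : IsBoundedMeasurable f) (T : Finset (Fin n)) :
    IsBoundedMeasurable (avg ν T f) := by
  obtain ⟨C, hC⟩ := hf.2
  refine .of_mem_Icc (lo := -C) (hi := C) ?_
    (avg_mem_Icc T hf fun x => abs_le.1 (hC x))
  have : Measurable (fun p : (Fin n → S) × (Fin n → S) => f (T.piecewise p.2 p.1)) :=
    hf.1.comp ((measurable_piecewise T).comp measurable_swap)
  exact (this.stronglyMeasurable.integral_prod_right
    (ν := Measure.pi fun _ : Fin n => ν)).measurable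

lemma integral_avg (hf : IsBoundedMeasurable f) (T : Finset (Fin n)) :
    ∫ x, avg ν T f x ∂Measure.pi (fun _ => ν) = ∫ x, f x ∂Measure.pi (fun _ => ν) := by
  have hmp := measurePreserving_piecewise ν T
  rw [← hmp.map_eq, integral_map hmp.measurable.aemeasurable hf.1.aestronglyMeasurable,
    integral_prod_symm]
  · rw [hmp.map_eq]; rfl
  · obtain ⟨C, hC⟩ := hf.2
    exact Integrable.of_bound (hf.1.comp hmp.measurable).aestronglyMeasurable C
      (Filter.Eventually.of_forall fun _ => hC _)

lemma avg_piecewise (T : Finset (Fin n)) (f : (Fin n → S) → ℝ) (x x' : Fin n → S) :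
    avg ν T f (T.piecewise x' x) = avg ν T f x := by
  unfold avg
  congr 1 with y
  congr 1
  ext i
  by_cases hi : i ∈ T <;> simp [hi]

lemma avg_mul_of_invariant (T : Finset (Fin n)) (hg : ∀ x x', g (T.piecewise x' x) = g x)
    (x : Fin n → S) : avg ν T (fun x => g x * f x) x = g x * avg ν T f x := by
  simp only [avg, hg]
  exact integral_const_mul _ _

/-- A factor that ignores the coordinates in `T` passes through the average. The orthogonality
relations below all come from this. -/
lemma integral_mul_avg (hg : IsBoundedMeasurable g) (hf : IsBoundedMeasurable f)
    (T : Finset (Fin n)) (hginv : ∀ x x', g (T.piecewise x' x) = g x) :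
    ∫ x, g x * avg ν T f x ∂Measure.pi (fun _ => ν) =
      ∫ x, g x * f x ∂Measure.pi (fun _ => ν) := by
  rw [← integral_avg (hg.mul hf) T]
  simp only [avg_mul_of_invariant T hginv]

lemma avg_insert (hf : IsBoundedMeasurable f) (T : Finset (Fin n)) (k : Fin n)
    (x : Fin n → S) : avg ν (insert k T) f x = avg ν T (avg ν {k} f) x := by
  have hmp := measurePreserving_piecewise ν ({k} : Finset (Fin n))
  have hm : Measurable (fun x' : Fin n → S => f ((insert k T).piecewise x' x)) :=
    hf.1.comp ((measurable_piecewise _).comp (measurable_id.prodMk measurable_const))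
  obtain ⟨C, hC⟩ := hf.2
  unfold avg
  nth_rewrite 1 [← hmp.map_eq]
  rw [integral_map hmp.measurable.aemeasurable hm.aestronglyMeasurable, integral_prod_symm]
  · congr 1 with x'
    congr 1 with x''
    congr 1
    ext i
    by_cases hi : i = k
    · subst hi; simp
    · by_cases hT : i ∈ T <;> simp [Finset.piecewise, hi, hT]
  · exact Integrable.of_bound (hm.comp hmp.measurable).aestronglyMeasurable C
      (Filter.Eventually.of_forall fun _ => hC _)

lemma avg_singleton (hf : IsBoundedMeasurable f) (k : Fin n) (x : Fin n → S) :
    avg ν {k} f x = ∫ y, f (Function.update x k y) ∂ν := by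
  have hmp := measurePreserving_eval (fun _ : Fin n => ν) k
  have hm : Measurable (fun y => f (Function.update x k y)) := hf.1.comp (measurable_update x)
  rw [← hmp.map_eq, integral_map hmp.measurable.aemeasurable hm.aestronglyMeasurable]
  rw [hmp.map_eq]
  simp only [avg, Finset.piecewise_singleton, Function.eval]

lemma avg_empty (f : (Fin n → S) → ℝ) (x : Fin n → S) : avg ν ∅ f x = f x := by
  simp [avg]

lemma avg_univ (f : (Fin n → S) → ℝ) (x : Fin n → S) :
    avg ν Finset.univ f x = ∫ x, f x ∂Measure.pi (fun _ => ν) := by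
  simp [avg]

end Averaging

/-! ### Subadditivity of entropy; Efron-Stein inequality and its reverse -/

section Tensorization

variable {S : Type*} [MeasurableSpace S] {n : ℕ} {ν : Measure S} [IsProbabilityMeasure ν]
  {f : (Fin n → S) → ℝ}

lemma IsBoundedMeasurable.comp_continuousOn {φ : ℝ → ℝ} {lo hi : ℝ}
    (hf : Measurable f) (hI : ∀ x, f x ∈ Set.Icc lo hi) (hφm : Measurable φ)
    (hφ : ContinuousOn φ (Set.Icc lo hi)) : IsBoundedMeasurable (fun x => φ (f x)) := by
  obtain ⟨D, hD⟩ := (isCompact_Icc (a := lo) (b := hi)).exists_bound_of_continuousOn hφ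
  exact ⟨hφm.comp hf, D, fun x => hD _ (hI x)⟩

lemma IsBoundedMeasurable.log {lo hi : ℝ} (hlo : 0 < lo)
    (hf : Measurable f) (hI : ∀ x, f x ∈ Set.Icc lo hi) :
    IsBoundedMeasurable (fun x => Real.log (f x)) :=
  .comp_continuousOn hf hI Real.measurable_log
    (Real.continuousOn_log.mono fun x hx => by simp; linarith [hx.1])

lemma IsBoundedMeasurable.inv {lo hi : ℝ} (hlo : 0 < lo)
    (hf : Measurable f) (hI : ∀ x, f x ∈ Set.Icc lo hi) :
    IsBoundedMeasurable (fun x => (f x)⁻¹) :=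
  .comp_continuousOn hf hI measurable_inv
    (continuousOn_inv₀.mono fun x hx => by simp; linarith [hx.1])

lemma avg_pos_mem {lo hi : ℝ} (hf : Measurable f)
    (hI : ∀ x, f x ∈ Set.Icc lo hi) (T : Finset (Fin n)) :
    Measurable (avg ν T f) ∧ ∀ x, avg ν T f x ∈ Set.Icc lo hi :=
  ⟨((IsBoundedMeasurable.of_mem_Icc hf hI).avg T).1,
    avg_mem_Icc T (.of_mem_Icc hf hI) hI⟩

/-- Subadditivity of entropy, in partially averaged form. -/
lemma entropy_avg_le {F : (Fin n → S) → ℝ} {lo hi : ℝ} (hlo : 0 < lo) (hF : Measurable F)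
    (hI : ∀ x, F x ∈ Set.Icc lo hi) (T : Finset (Fin n)) :
    ∫ x, F x * (Real.log (F x) - Real.log (avg ν T F x)) ∂Measure.pi (fun _ => ν) ≤
      ∑ k ∈ T, ∫ x, F x * (Real.log (F x) - Real.log (avg ν {k} F x))
        ∂Measure.pi (fun _ => ν) := by
  have hFb := IsBoundedMeasurable.of_mem_Icc hF hI
  have hlF := IsBoundedMeasurable.log hlo hF hI
  induction T using Finset.induction_on with
  | empty => simp [avg_empty]
  | insert k T hk ih =>
    rw [Finset.sum_insert hk, ← sub_le_iff_le_add']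
    refine le_trans ?_ ih
    obtain ⟨m1, I1⟩ := avg_pos_mem (ν := ν) hF hI T
    obtain ⟨m2, I2⟩ := avg_pos_mem (ν := ν) hF hI {k}
    obtain ⟨m3, I3⟩ := avg_pos_mem (ν := ν) m2 I2 T
    have b1 := IsBoundedMeasurable.of_mem_Icc m1 I1
    have b2 := IsBoundedMeasurable.of_mem_Icc m2 I2
    have l1 := IsBoundedMeasurable.log hlo m1 I1
    have l2 := IsBoundedMeasurable.log hlo m2 I2
    have l3 := IsBoundedMeasurable.log hlo m3 I3
    have i3 := IsBoundedMeasurable.inv hlo m3 I3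
    have hins : avg ν (insert k T) F = avg ν T (avg ν {k} F) :=
      funext fun x => avg_insert hFb T k x
    have h13 := b1.mul i3
    -- The induction step is `log q ≤ q - 1`, weighted by `F`, for `q = E_T F · E_k F / (E_T E_k F ·
    -- F)`. The right side integrates to zero: the first two factors ignore the coordinates in `T`,
    -- so `E_k F` may be averaged over `T`, which cancels the denominator.
    have key : ∫ x, avg ν T F x * (avg ν T (avg ν {k} F) x)⁻¹ * avg ν {k} F x
        ∂Measure.pi (fun _ => ν) = ∫ x, F x ∂Measure.pi (fun _ => ν) := by
      rw [← integral_mul_avg h13 b2 T (fun x x' => by simp only [avg_piecewise]),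
        ← integral_avg hFb T]
      refine integral_congr_ae (Filter.Eventually.of_forall fun x => ?_)
      have := (hlo.trans_le (I3 x).1).ne'
      simp only [mul_assoc, inv_mul_cancel₀ this, mul_one]
    rw [hins, ← integral_sub ((hFb.mul (hlF.sub l3)).integrable)
      ((hFb.mul (hlF.sub l2)).integrable), ← sub_nonpos,
      ← integral_sub (((hFb.mul (hlF.sub l3)).sub (hFb.mul (hlF.sub l2))).integrable)
      ((hFb.mul (hlF.sub l1)).integrable)]
    refine (integral_mono (((hFb.mul (hlF.sub l3)).sub (hFb.mul (hlF.sub l2))).sub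
      (hFb.mul (hlF.sub l1))).integrable ((h13.mul b2).sub hFb).integrable
      fun x => ?_).trans ?_
    · have p0 := hlo.trans_le (hI x).1
      have p1 := hlo.trans_le (I1 x).1
      have p2 := hlo.trans_le (I2 x).1
      have p3 := hlo.trans_le (I3 x).1
      have hq : 0 < avg ν T F x * (avg ν T (avg ν {k} F) x)⁻¹ * avg ν {k} F x * (F x)⁻¹ := by
        positivity
      have h := Real.log_le_sub_one_of_pos hq
      rw [Real.log_mul (by positivity) (by positivity), Real.log_mul (by positivity) p2.ne',
        Real.log_mul p1.ne' (by positivity), Real.log_inv, Real.log_inv] at h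
      have h' := mul_le_mul_of_nonneg_left h p0.le
      have e : F x * (avg ν T F x * (avg ν T (avg ν {k} F) x)⁻¹ * avg ν {k} F x * (F x)⁻¹ - 1)
          = avg ν T F x * (avg ν T (avg ν {k} F) x)⁻¹ * avg ν {k} F x - F x := by
        field_simp
      rw [e] at h'
      refine le_trans (le_of_eq ?_) h'
      ring
    · rw [integral_sub (h13.mul b2).integrable hFb.integrable, key, sub_self]

/-- The mean square of the difference of `f` and its average. -/
lemma integral_sub_avg_sq (hf : IsBoundedMeasurable f) (T : Finset (Fin n)) :
    ∫ x, (f x - avg ν T f x) ^ 2 ∂Measure.pi (fun _ => ν) =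
      ∫ x, f x ^ 2 ∂Measure.pi (fun _ => ν)
        - ∫ x, avg ν T f x ^ 2 ∂Measure.pi (fun _ => ν) := by
  have ha := hf.avg (ν := ν) T
  have h1 : ∫ x, avg ν T f x * f x ∂Measure.pi (fun _ => ν)
      = ∫ x, avg ν T f x ^ 2 ∂Measure.pi (fun _ => ν) := by
    rw [← integral_mul_avg ha hf T (fun x x' => avg_piecewise T f x x')]
    simp only [pow_two]
  have h2 : ∀ x, (f x - avg ν T f x) ^ 2
      = f x ^ 2 + avg ν T f x ^ 2 - 2 * (avg ν T f x * f x) := fun x => by ring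
  simp only [h2]
  rw [integral_sub (hf.sq.add ha.sq).integrable ((ha.mul hf).const_mul 2).integrable,
    integral_add hf.sq.integrable ha.sq.integrable, integral_const_mul, h1]
  ring

lemma avg_sub {g : (Fin n → S) → ℝ} (hf : IsBoundedMeasurable f) (hg : IsBoundedMeasurable g)
    (T : Finset (Fin n)) (x : Fin n → S) :
    avg ν T (fun x => f x - g x) x = avg ν T f x - avg ν T g x :=
  integral_sub (hf.integrable_piecewise T x) (hg.integrable_piecewise T x)

/-- Splitting off one coordinate in the mean square of the difference of `f` and its average. -/
lemma integral_sub_avg_insert_sq (hf : IsBoundedMeasurable f) (T : Finset (Fin n)) (k : Fin n) :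
    ∫ x, (f x - avg ν (insert k T) f x) ^ 2 ∂Measure.pi (fun _ => ν) =
      ∫ x, (f x - avg ν T f x) ^ 2 ∂Measure.pi (fun _ => ν)
      + ∫ x, (f x - avg ν {k} f x) ^ 2 ∂Measure.pi (fun _ => ν)
      - ∫ x, ((f x - avg ν {k} f x) - avg ν T (fun x => f x - avg ν {k} f x) x) ^ 2
        ∂Measure.pi (fun _ => ν) := by
  have hk := hf.avg (ν := ν) {k}
  have hT := hf.avg (ν := ν) T
  have hTk := hf.avg (ν := ν) (insert k T)
  have hh := hf.sub hk
  have hAh : ∀ x, avg ν T (fun x => f x - avg ν {k} f x) x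
      = avg ν T f x - avg ν (insert k T) f x := fun x => by
    rw [avg_sub hf hk, avg_insert hf]
  have hinv : ∀ x x', avg ν (insert k T) f (T.piecewise x' x) = avg ν (insert k T) f x := by
    intro x x'
    rw [avg_insert hf, avg_insert hf, avg_piecewise]
  -- Nested averages are nested orthogonal projections, so Pythagoras applies to `E_T f - E_T E_k
  -- f`.
  have h1 : ∫ x, avg ν (insert k T) f x * avg ν T f x ∂Measure.pi (fun _ => ν)
      = ∫ x, avg ν (insert k T) f x ^ 2 ∂Measure.pi (fun _ => ν) := by
    rw [integral_mul_avg hTk hf T hinv,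
      ← integral_mul_avg hTk hf (insert k T) (fun x x' => avg_piecewise _ f x x')]
    simp only [pow_two]
  have h2 : ∫ x, (avg ν T f x - avg ν (insert k T) f x) ^ 2 ∂Measure.pi (fun _ => ν)
      = ∫ x, avg ν T f x ^ 2 ∂Measure.pi (fun _ => ν)
        - ∫ x, avg ν (insert k T) f x ^ 2 ∂Measure.pi (fun _ => ν) := by
    have e : ∀ x, (avg ν T f x - avg ν (insert k T) f x) ^ 2 = avg ν T f x ^ 2
        + avg ν (insert k T) f x ^ 2 - 2 * (avg ν (insert k T) f x * avg ν T f x) :=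
      fun x => by ring
    simp only [e]
    rw [integral_sub (hT.sq.add hTk.sq).integrable ((hTk.mul hT).const_mul 2).integrable,
      integral_add hT.sq.integrable hTk.sq.integrable, integral_const_mul, h1]
    ring
  rw [integral_sub_avg_sq hh T, integral_sub_avg_sq hf T, integral_sub_avg_sq hf (insert k T)]
  simp only [hAh]
  rw [h2]
  ring

/-- The Efron-Stein inequality. -/
lemma integral_sub_avg_sq_le (hf : IsBoundedMeasurable f) (T : Finset (Fin n)) :
    ∫ x, (f x - avg ν T f x) ^ 2 ∂Measure.pi (fun _ => ν) ≤
      ∑ k ∈ T, ∫ x, (f x - avg ν {k} f x) ^ 2 ∂Measure.pi (fun _ => ν) := by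
  induction T using Finset.induction_on with
  | empty => simp [avg_empty]
  | insert k T hk ih =>
    rw [Finset.sum_insert hk, integral_sub_avg_insert_sq hf]
    have : 0 ≤ ∫ x, ((f x - avg ν {k} f x) - avg ν T (fun x => f x - avg ν {k} f x) x) ^ 2
        ∂Measure.pi (fun _ => ν) := integral_nonneg fun x => sq_nonneg _
    linarith

/-- A reverse Efron-Stein inequality: the deficit is controlled by second order terms. -/
lemma sum_integral_sub_avg_sq_le (hf : IsBoundedMeasurable f) {q : ℝ}
    (hq : ∀ k l : Fin n, l ≠ k →
      ∫ x, ((f x - avg ν {k} f x) - avg ν {l} (fun x => f x - avg ν {k} f x) x) ^ 2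
        ∂Measure.pi (fun _ => ν) ≤ q) (T : Finset (Fin n)) :
    ∑ k ∈ T, ∫ x, (f x - avg ν {k} f x) ^ 2 ∂Measure.pi (fun _ => ν) ≤
      ∫ x, (f x - avg ν T f x) ^ 2 ∂Measure.pi (fun _ => ν)
        + T.card * ((T.card : ℝ) - 1) / 2 * q := by
  induction T using Finset.induction_on with
  | empty => simp [avg_empty]
  | insert k T hk ih =>
    rw [Finset.sum_insert hk, integral_sub_avg_insert_sq hf, Finset.card_insert_of_notMem hk]
    -- The term subtracted in the splitting identity is itself bounded by Efron-Stein, applied to `f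
    -- - E_k f`. It costs `T.card * q` at each insertion, and `0 + 1 + 2 + ...` produces the
    -- binomial coefficient.
    have h1 := integral_sub_avg_sq_le (ν := ν) (hf.sub (hf.avg (ν := ν) {k})) T
    have h2 := Finset.sum_le_sum fun l (hl : l ∈ T) =>
      hq k l (fun h => hk (h ▸ hl))
    rw [Finset.sum_const, nsmul_eq_mul] at h2
    push_cast
    linarith

end Tensorization

/-! ### Estimates for the exponential remainder -/

/-- The remainder `exp t - 1 - t`. -/
noncomputable def expRem (t : ℝ) : ℝ := Real.exp t - 1 - t

lemma expRem_nonneg (t : ℝ) : 0 ≤ expRem t := by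
  have := Real.add_one_le_exp t
  unfold expRem; linarith

lemma continuous_expRem : Continuous expRem := by unfold expRem; fun_prop

/-- By convexity of `exp`, `expRem (θ x) ≤ θ * expRem x` for `θ ∈ [0, 1]`; take `θ = d / D`. The
sign of `s` is free, so both tails are covered. -/
lemma expRem_mul_le_expRem_mul (s : ℝ) {d D : ℝ} (hd : 0 ≤ d) (hdD : d ≤ D) :
    expRem (s * d) ≤ expRem (s * D) := by
  rcases (hd.trans hdD).eq_or_lt with h | h
  · have : d = D := le_antisymm hdD (h ▸ hd)
    rw [this]
  have hθ0 : 0 ≤ d / D := by positivity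
  have hθ1 : d / D ≤ 1 := (div_le_one h).2 hdD
  have hconv := convexOn_exp.2 (Set.mem_univ (0 : ℝ)) (Set.mem_univ (s * D))
    (sub_nonneg.2 hθ1) hθ0 (by ring)
  have e : (1 - d / D) • (0 : ℝ) + (d / D) • (s * D) = s * d := by
    simp only [smul_eq_mul]; field_simp; ring
  rw [e] at hconv
  simp only [smul_eq_mul, Real.exp_zero, mul_one] at hconv
  have e2 : s * d = d / D * (s * D) := by field_simp
  have h1 : expRem (s * d) ≤ d / D * expRem (s * D) := by
    unfold expRem; nlinarith [hconv, e2]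
  exact h1.trans (mul_le_of_le_one_left (expRem_nonneg _) hθ1)

lemma hasSum_expRem (x : ℝ) :
    HasSum (fun k : ℕ => x ^ (k + 2) / ((k + 2).factorial : ℝ)) (expRem x) := by
  have h := NormedSpace.expSeries_div_hasSum_exp (x : ℝ)
  rw [← Real.exp_eq_exp_ℝ, ← hasSum_nat_add_iff' 2] at h
  have e : expRem x = Real.exp x - ∑ i ∈ Finset.range 2, x ^ i / (i.factorial : ℝ) := by
    simp [expRem, Finset.sum_range_succ]
    ring
  rwa [e]

/-- The power series starts at degree two and has nonnegative terms, so each term yields a factor `d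
^ 2`. -/
lemma expRem_mul_le_sq_mul {x d : ℝ} (hx : 0 ≤ x) (hd0 : 0 ≤ d) (hd1 : d ≤ 1) :
    expRem (x * d) ≤ d ^ 2 * expRem x := by
  refine hasSum_le (fun k => ?_) (hasSum_expRem (x * d)) ((hasSum_expRem x).mul_left (d ^ 2))
  rw [mul_pow, ← mul_div_assoc]
  refine div_le_div_of_nonneg_right ?_ (by positivity)
  have : d ^ (k + 2) ≤ d ^ 2 := pow_le_pow_of_le_one hd0 hd1 (by omega)
  have hx' : 0 ≤ x ^ (k + 2) := by positivity
  nlinarith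

/-- Invert `1 + t + t² / 2 ≤ exp t`, using `(1 + t + t² / 2) (1 - t + t² / 2) = 1 + t⁴ / 4 ≥ 1`. -/
lemma expRem_neg_le {t : ℝ} (ht : 0 ≤ t) : expRem (-t) ≤ t ^ 2 / 2 := by
  have h := Real.quadratic_le_exp_of_nonneg ht
  have h2 : Real.exp (-t) * Real.exp t = 1 := by rw [← Real.exp_add]; simp
  have h3 := Real.exp_pos (-t)
  have h4 : Real.exp (-t) * (1 + t + t ^ 2 / 2) ≤ 1 := by
    exact (mul_le_mul_of_nonneg_left h h3.le).trans_eq h2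
  have h5 : Real.exp (-t) ≤ 1 - t + t ^ 2 / 2 := by
    refine le_of_mul_le_mul_right (h4.trans ?_) (by positivity : 0 < 1 + t + t ^ 2 / 2)
    nlinarith [sq_nonneg (t ^ 2)]
  unfold expRem; linarith

/-! ### Entropy of exponentials in terms of decrements -/

section Entropy

variable {S : Type*} [MeasurableSpace S]

/-- The entropy of `exp (s * z)` on one coordinate, in terms of the decrements of `z`. -/
lemma entropy_exp_le_of_sub_le (ν : Measure S) [IsProbabilityMeasure ν] {z D : S → ℝ}
    (hz : Measurable z) {C : ℝ} (hC : ∀ y, |z y| ≤ C) (hD : Measurable D) {C' : ℝ}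
    (hC' : ∀ y, |D y| ≤ C') (hzD : ∀ y y', z y - z y' ≤ D y) (s : ℝ) :
    ∫ y, Real.exp (s * z y) * (s * z y - Real.log (∫ y, Real.exp (s * z y) ∂ν)) ∂ν ≤
      ∫ y, Real.exp (s * z y) * expRem (-s * D y) ∂ν := by
  have hbdd : BddBelow (Set.range z) := ⟨-C, by
    rintro _ ⟨y, rfl⟩; exact (abs_le.1 (hC y)).1⟩
  have : Nonempty S := nonempty_of_isProbabilityMeasure ν
  set z0 := ⨅ y, z y with hz0
  have hd0 : ∀ y, 0 ≤ z y - z0 := fun y => sub_nonneg.2 (ciInf_le hbdd y)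
  have hdD : ∀ y, z y - z0 ≤ D y := fun y => by
    have : z y - D y ≤ z0 := le_ciInf fun y' => by linarith [hzD y y']
    linarith
  have bdd_int : ∀ φ : ℝ × ℝ → ℝ, Continuous φ → Integrable (fun y => φ (z y, D y)) ν := by
    intro φ hφ
    obtain ⟨B, hB⟩ := ((isCompact_Icc (a := -C) (b := C)).prod
      (isCompact_Icc (a := -C') (b := C'))).exists_bound_of_continuousOn hφ.continuousOn
    exact Integrable.of_bound (hφ.measurable.comp (hz.prodMk hD)).aestronglyMeasurable B
      (Filter.Eventually.of_forall fun y => hB _ ⟨abs_le.1 (hC y), abs_le.1 (hC' y)⟩)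
  have i1 : Integrable (fun y => Real.exp (s * z y)) ν :=
    bdd_int (fun p => Real.exp (s * p.1)) (by fun_prop)
  have i2 : Integrable (fun y => Real.exp (s * z y) * (s * z y)) ν :=
    bdd_int (fun p => Real.exp (s * p.1) * (s * p.1)) (by fun_prop)
  have i3 : Integrable (fun y => Real.exp (s * z y) * expRem (-s * D y)) ν :=
    bdd_int (fun p => Real.exp (s * p.1) * expRem (-s * p.2))
      (by have := continuous_expRem; fun_prop)
  set E := ∫ y, Real.exp (s * z y) ∂ν with hE
  have hEpos : 0 < E := by
    have : Real.exp (-(|s| * C)) ≤ E := by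
      have h := integral_mono (μ := ν) (integrable_const (Real.exp (-(|s| * C)))) i1 (fun y => ?_)
      · simpa using h
      · refine Real.exp_le_exp.2 ?_
        have h1 : |s * z y| ≤ |s| * C := by
          rw [abs_mul]; exact mul_le_mul_of_nonneg_left (hC y) (abs_nonneg _)
        exact (abs_le.1 h1).1
    exact (Real.exp_pos _).trans_le this
  -- Variational bound for the entropy with reference value `exp (s * z0)`, where `z0` is the
  -- infimum of `z`. The integrand then becomes `exp (s z) * expRem (-s (z - z0))`, and `0 ≤ z - z0
  -- ≤ D`.
  have hlog : E * (s * z0) + E - Real.exp (s * z0) ≤ E * Real.log E := by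
    have h := Real.log_le_sub_one_of_pos (div_pos (Real.exp_pos (s * z0)) hEpos)
    rw [Real.log_div (Real.exp_pos _).ne' hEpos.ne', Real.log_exp] at h
    have h' := mul_le_mul_of_nonneg_left h hEpos.le
    have e : E * (Real.exp (s * z0) / E - 1) = Real.exp (s * z0) - E := by field_simp
    rw [e] at h'
    linarith
  have e1 : ∫ y, Real.exp (s * z y) * (s * z y - Real.log E) ∂ν
      = ∫ y, Real.exp (s * z y) * (s * z y) ∂ν - E * Real.log E := by
    simp only [mul_sub]
    rw [integral_sub i2 (i1.mul_const _), integral_mul_const]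
  have e2 : ∫ y, (Real.exp (s * z y) * (s * z y) - Real.exp (s * z y) * (s * z0 + 1)
        + Real.exp (s * z0)) ∂ν
      = ∫ y, Real.exp (s * z y) * (s * z y) ∂ν - E * (s * z0 + 1) + Real.exp (s * z0) := by
    have i4 : Integrable (fun y => Real.exp (s * z y) * (s * z y)
        - Real.exp (s * z y) * (s * z0 + 1)) ν := i2.sub (i1.mul_const _)
    rw [integral_add i4 (integrable_const _), integral_sub i2 (i1.mul_const _), integral_mul_const]
    simp [hE]
  have h3 := integral_mono ((i2.sub (i1.mul_const (s * z0 + 1))).add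
    (integrable_const (Real.exp (s * z0)))) i3 (fun y => ?_)
  · simp only [Pi.add_apply, Pi.sub_apply] at h3
    rw [e2] at h3
    rw [e1]
    linarith
  · have h4 := expRem_mul_le_expRem_mul (-s) (hd0 y) (hdD y)
    have h5 := mul_le_mul_of_nonneg_left h4 (Real.exp_pos (s * z y)).le
    refine le_trans (le_of_eq ?_) h5
    have : Real.exp (s * z0) = Real.exp (s * z y) * Real.exp (-s * (z y - z0)) := by
      rw [← Real.exp_add]; congr 1; ring
    simp only [Pi.add_apply, Pi.sub_apply, this, expRem]
    ring

variable {n : ℕ} {ν : Measure S} [IsProbabilityMeasure ν]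

/-- The entropy of `exp (s * Z)` under a product measure, in terms of coordinate decrements. -/
lemma entropy_exp_le {Z : (Fin n → S) → ℝ} (hZ : IsBoundedMeasurable Z)
    {D : Fin n → (Fin n → S) → ℝ} (hDm : ∀ k, IsBoundedMeasurable (D k))
    (hD : ∀ k x y, Z x - Z (Function.update x k y) ≤ D k x) (s : ℝ) :
    s * ∫ x, Z x * Real.exp (s * Z x) ∂Measure.pi (fun _ => ν)
      - (∫ x, Real.exp (s * Z x) ∂Measure.pi (fun _ => ν))
        * Real.log (∫ x, Real.exp (s * Z x) ∂Measure.pi (fun _ => ν)) ≤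
    ∫ x, Real.exp (s * Z x) * ∑ k, expRem (-s * D k x) ∂Measure.pi (fun _ => ν) := by
  obtain ⟨C, hC⟩ := hZ.2
  set F : (Fin n → S) → ℝ := fun x => Real.exp (s * Z x) with hFdef
  have hFb : IsBoundedMeasurable F :=
    hZ.comp_continuous (φ := fun t => Real.exp (s * t)) (by fun_prop)
  have hI : ∀ x, F x ∈ Set.Icc (Real.exp (-(|s| * C))) (Real.exp (|s| * C)) := fun x => by
    have h1 : |s * Z x| ≤ |s| * C := by
      rw [abs_mul]; exact mul_le_mul_of_nonneg_left (hC x) (abs_nonneg _)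
    exact ⟨Real.exp_le_exp.2 (abs_le.1 h1).1, Real.exp_le_exp.2 (abs_le.1 h1).2⟩
  have hT := entropy_avg_le (ν := ν) (Real.exp_pos _) hFb.1 hI Finset.univ
  have hlogF : ∀ x, Real.log (F x) = s * Z x := fun x => Real.log_exp _
  have hsZ := hZ.const_mul s
  have hrem : ∀ k, IsBoundedMeasurable (fun x => expRem (-s * D k x)) := fun k =>
    (hDm k).comp_continuous (φ := fun t => expRem (-s * t))
      (by have := continuous_expRem; fun_prop)
  have hL : ∫ x, F x * (Real.log (F x) - Real.log (avg ν Finset.univ F x))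
      ∂Measure.pi (fun _ => ν) = s * ∫ x, Z x * Real.exp (s * Z x) ∂Measure.pi (fun _ => ν)
      - (∫ x, Real.exp (s * Z x) ∂Measure.pi (fun _ => ν))
        * Real.log (∫ x, Real.exp (s * Z x) ∂Measure.pi (fun _ => ν)) := by
    simp only [avg_univ, hlogF, mul_sub]
    rw [integral_sub (hFb.mul hsZ).integrable
      (hFb.mul (IsBoundedMeasurable.const _)).integrable, integral_mul_const,
      ← integral_const_mul]
    congr 1
    congr 1 with x
    simp only [hFdef]; ring
  rw [hL] at hT
  refine hT.trans ?_
  simp only [Finset.mul_sum]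
  rw [integral_finsetSum _ fun k _ => (hFb.mul (hrem k)).integrable]
  refine Finset.sum_le_sum fun k _ => ?_
  obtain ⟨m2, I2⟩ := avg_pos_mem (ν := ν) hFb.1 hI {k}
  have l2 := IsBoundedMeasurable.log (Real.exp_pos _) m2 I2
  have hb1 := hFb.mul (hsZ.sub l2)
  have hb2 := hFb.mul (hrem k)
  simp only [hlogF]
  -- Averaging over the coordinate `k` freezes the others and leaves the one-dimensional bound.
  rw [← integral_avg hb1 {k}, ← integral_avg hb2 {k}]
  refine integral_mono (hb1.avg _).integrable (hb2.avg _).integrable fun x => ?_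
  have hconst : ∀ y, avg ν {k} F (Function.update x k y) = avg ν {k} F x := fun y => by
    have := avg_piecewise (ν := ν) {k} F x (fun _ => y)
    rwa [Finset.piecewise_singleton] at this
  simp only []
  rw [avg_singleton hb1, avg_singleton hb2]
  simp only [hconst]
  rw [avg_singleton hFb]
  obtain ⟨C', hC'⟩ := (hDm k).2
  refine entropy_exp_le_of_sub_le ν (hZ.1.comp (measurable_update x)) (fun y => hC _)
    ((hDm k).1.comp (measurable_update x)) (fun y => hC' _) (fun y y' => ?_) s
  have := hD k (Function.update x k y) y'
  rwa [Function.update_idem] at this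

end Entropy

/-! ### Herbst's argument; exponential moments with positive exponents -/

/-- A differential inequality for `H * y`, integrated from `0`. -/
lemma mul_le_of_deriv_nonpos {H H' y y' : ℝ → ℝ} {h0 T : ℝ}
    (hH : ∀ t, 0 < t → t < T → HasDerivAt H (H' t) t)
    (hy : ∀ t, 0 < t → t < T → HasDerivAt y (y' t) t)
    (hle : ∀ t, 0 < t → t < T → H' t * y t + H t * y' t ≤ 0)
    (hH0 : H 0 = 0) (hHd : HasDerivAt H h0 0)
    (hy0 : Filter.Tendsto (fun t => t * y t) (nhdsWithin 0 (Set.Ioi 0)) (nhds 1))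
    {t : ℝ} (ht0 : 0 < t) (htT : t < T) : H t * y t ≤ h0 := by
  have hd : ∀ s ∈ Set.Ioo 0 T, HasDerivAt (fun s => H s * y s) (H' s * y s + H s * y' s) s :=
    fun s hs => (hH s hs.1 hs.2).mul (hy s hs.1 hs.2)
  have hanti : AntitoneOn (fun s => H s * y s) (Set.Ioo 0 T) := by
    refine antitoneOn_of_deriv_nonpos (convex_Ioo 0 T)
      (fun s hs => (hd s hs).continuousAt.continuousWithinAt) ?_ ?_
    · rw [interior_Ioo]
      exact fun s hs => (hd s hs).differentiableAt.differentiableWithinAt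
    · rw [interior_Ioo]
      intro s hs
      rw [(hd s hs).deriv]
      exact hle s hs.1 hs.2
  have hslope := hHd.tendsto_slope_zero_right
  simp only [zero_add, hH0, sub_zero, smul_eq_mul] at hslope
  -- Since `H s ~ h0 s` and `y s ~ 1 / s`, the nonincreasing function `H y` tends to `h0` at `0`.
  have hlim := hslope.mul hy0
  rw [mul_one] at hlim
  refine ge_of_tendsto hlim ?_
  filter_upwards [Ioo_mem_nhdsGT ht0] with s hs
  have h := hanti ⟨hs.1, hs.2.trans htT⟩ ⟨ht0, htT⟩ hs.2.le
  have : s⁻¹ * H s * (s * y s) = H s * y s := by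
    have := hs.1.ne'
    field_simp
  rw [this]
  exact h

section Laplace

variable {S : Type*} [MeasurableSpace S] {n : ℕ}

lemma IsBoundedMeasurable.integrable_exp {Z : (Fin n → S) → ℝ}
    (hZ : IsBoundedMeasurable Z) (P : Measure (Fin n → S)) [IsFiniteMeasure P] (s : ℝ) :
    Integrable (fun x => Real.exp (s * Z x)) P :=
  (hZ.comp_continuous (φ := fun z => Real.exp (s * z)) (by fun_prop)).integrable

lemma IsBoundedMeasurable.mem_interior_integrableExpSet {Z : (Fin n → S) → ℝ}
    (hZ : IsBoundedMeasurable Z) (P : Measure (Fin n → S)) [IsFiniteMeasure P] (s : ℝ) :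
    s ∈ interior (integrableExpSet Z P) := by
  have : integrableExpSet Z P = Set.univ := Set.eq_univ_of_forall fun t => hZ.integrable_exp P t
  simp [this]

variable {ν : Measure S} [IsProbabilityMeasure ν] {Z : (Fin n → S) → ℝ}
  {D : Fin n → (Fin n → S) → ℝ}

lemma hasDerivAt_cgf_of_bounded (hZ : IsBoundedMeasurable Z) (s : ℝ) :
    HasDerivAt (cgf Z (Measure.pi fun _ : Fin n => ν))
      ((∫ x, Z x * Real.exp (s * Z x) ∂Measure.pi (fun _ => ν))
        / mgf Z (Measure.pi fun _ : Fin n => ν) s) s := by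
  have h := hZ.mem_interior_integrableExpSet (Measure.pi fun _ : Fin n => ν) s
  exact (hasDerivAt_mgf h).log (mgf_pos (hZ.integrable_exp _ s)).ne'

/-- Exponential moments of weakly self-bounding functions, positive exponents. -/
lemma mgf_le_of_selfBounding (hZ : IsBoundedMeasurable Z)
    (hDm : ∀ k, IsBoundedMeasurable (D k))
    (hD : ∀ k x y, Z x - Z (Function.update x k y) ≤ D k x)
    {c : ℝ} (hc : 0 < c) (hDc : ∀ x, ∑ k, D k x ^ 2 ≤ c * Z x)
    {s : ℝ} (hs0 : 0 < s) (hs : s < 2 / c) :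
    mgf Z (Measure.pi fun _ : Fin n => ν) s ≤
      Real.exp ((∫ x, Z x ∂Measure.pi (fun _ => ν)) / (1 / s - c / 2)) := by
  set P := Measure.pi fun _ : Fin n => ν with hP
  have hLpos : ∀ t, 0 < mgf Z P t := fun t =>
    mgf_pos (hZ.integrable_exp P t)
  have hD0 : ∀ k x, 0 ≤ D k x := fun k x => by simpa using hD k x (x k)
  have hypos : ∀ t, 0 < t → t < 2 / c → 0 < 1 / t - c / 2 := fun t h0 h1 => by
    rw [sub_pos, lt_div_iff₀ h0]
    rw [lt_div_iff₀ hc] at h1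
    linarith
  have hent : ∀ t, 0 < t → t * (∫ x, Z x * Real.exp (t * Z x) ∂P)
      - mgf Z P t * cgf Z P t ≤ c * t ^ 2 / 2 * ∫ x, Z x * Real.exp (t * Z x) ∂P := by
    intro t ht
    refine (entropy_exp_le (ν := ν) hZ hDm hD t).trans ?_
    rw [← integral_const_mul]
    have hexp := hZ.comp_continuous (φ := fun z => Real.exp (t * z)) (by fun_prop)
    refine integral_mono (hexp.mul (IsBoundedMeasurable.sum _ fun k _ =>
      (hDm k).comp_continuous (φ := fun z => expRem (-t * z))
        (by have := continuous_expRem; fun_prop))).integrable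
      ((hZ.mul hexp).const_mul _).integrable fun x => ?_
    have h1 : ∑ k, expRem (-t * D k x) ≤ ∑ k, t ^ 2 / 2 * D k x ^ 2 :=
      Finset.sum_le_sum fun k _ => by
        have := expRem_neg_le (mul_nonneg ht.le (hD0 k x))
        rw [neg_mul]
        linarith
    rw [← Finset.mul_sum] at h1
    have h2 := mul_le_mul_of_nonneg_left (hDc x) (by positivity : 0 ≤ t ^ 2 / 2)
    have h3 := mul_le_mul_of_nonneg_left (h1.trans h2) (Real.exp_pos (t * Z x)).le
    refine h3.trans (le_of_eq ?_)
    ring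
  have key := mul_le_of_deriv_nonpos (H := cgf Z P) (y := fun t => 1 / t - c / 2)
    (y' := fun t => -1 / t ^ 2) (h0 := ∫ x, Z x ∂P) (T := 2 / c)
    (fun t _ _ => hasDerivAt_cgf_of_bounded hZ t)
    (fun t ht _ => by
      have := (hasDerivAt_inv ht.ne').sub_const (c / 2)
      simpa [one_div, neg_div] using this)
    (fun t ht _ => by
      have h := hent t ht
      have hL := hLpos t
      -- With `y = 1 / t - c / 2`, the derivative of `H y` is the entropy bound divided by `mgf *
      -- t²`.
      have hL' := hL.ne'
      have ht' := ht.ne'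
      have e : ∀ I : ℝ, I / mgf Z P t * (1 / t - c / 2) + cgf Z P t * (-1 / t ^ 2)
          = (t * I - mgf Z P t * cgf Z P t - c * t ^ 2 / 2 * I) / (mgf Z P t * t ^ 2) := by
        intro I
        field_simp
        ring
      rw [← hP, e]
      exact div_nonpos_of_nonpos_of_nonneg (by linarith) (by positivity))
    (by simp) (by simpa using hasDerivAt_cgf_of_bounded (ν := ν) hZ 0)
    (by
      have h : Filter.Tendsto (fun t : ℝ => 1 - t * (c / 2)) (nhdsWithin 0 (Set.Ioi 0))
          (nhds 1) := by
        have : Continuous (fun t : ℝ => 1 - t * (c / 2)) := by fun_prop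
        simpa using (this.tendsto 0).mono_left nhdsWithin_le_nhds
      refine h.congr' ?_
      filter_upwards [self_mem_nhdsWithin] with t ht
      have : t ≠ 0 := (Set.mem_Ioi.1 ht).ne'
      field_simp)
    hs0 hs
  rw [← exp_cgf (hZ.integrable_exp P s)]
  refine Real.exp_le_exp.2 ?_
  rw [le_div_iff₀ (hypos s hs0 hs)]
  exact key

/-! ### Exponential moments with negative exponents -/

/-- The parameters `c`, `K`, `r` for which `K + c / (exp (c t) - 1)` solves the differential
inequality for the Laplace transform of a weakly self-bounding function. -/
structure LaplaceParam (r K c : ℝ) : Prop where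
  one_le : 1 ≤ c
  le_K : c ≤ K
  r_le : r ≤ c ^ 4
  T2 : 0 ≤ 2 * K - c - r
  T4 : 0 < c ^ 2 * (2 * K - c) - r
  disc : (c ^ 2 - r) ^ 2 ≤ 3 * (2 * K - c - r) * (c ^ 2 * (2 * K - c) - r)

/-- For `r ≥ 3` the choice `c = √r` makes the discriminant condition trivial. It violates `T2` near
`r = 12 / 5`, so `c = 4 / 3` is used for `r ≤ 3`. -/
lemma exists_laplaceParam {r : ℝ} (hr : 2 ≤ r) :
    ∃ c, LaplaceParam r (4 * r - 16 + 20 / r) c := by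
  have hr0 : 0 < r := by linarith
  obtain ⟨K, hK⟩ : ∃ K, K = 4 * r - 16 + 20 / r := ⟨_, rfl⟩
  rw [← hK]
  have hKr : K * r = 4 * r ^ 2 - 16 * r + 20 := by rw [hK]; field_simp
  rcases le_total r 3 with h3 | h3
  · refine ⟨4 / 3, by norm_num, ?_, by norm_num; linarith, ?_, ?_, ?_⟩
    · by_contra! h; nlinarith [sq_nonneg (r - 9 / 4)]
    · by_contra! h; nlinarith [sq_nonneg (r - 12 / 5)]
    · by_contra! h; nlinarith [sq_nonneg (r - 9 / 4)]
    · have hX : r * (2 * K - 4 / 3 - r) = 7 * r ^ 2 - 100 / 3 * r + 40 := by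
        linear_combination 2 * hKr
      have hY : r * ((4 / 3) ^ 2 * (2 * K - 4 / 3) - r)
          = 119 / 9 * r ^ 2 - 1600 / 27 * r + 640 / 9 := by
        linear_combination 32 / 9 * hKr
      -- Reduces `disc`, multiplied by `r²`, to constant bounds on its three factors; three
      -- subintervals of `[2, 3]` suffice.
      have aux : ∀ x y w : ℝ, 0 ≤ x → 0 ≤ y → 0 ≤ w → w ^ 2 ≤ 3 * x * y →
          x ≤ r * (2 * K - 4 / 3 - r) → y ≤ r * ((4 / 3) ^ 2 * (2 * K - 4 / 3) - r) →
          r * (r - (4 / 3) ^ 2) ≤ w →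
          ((4 / 3) ^ 2 - r) ^ 2 ≤ 3 * (2 * K - 4 / 3 - r) * ((4 / 3) ^ 2 * (2 * K - 4 / 3) - r) := by
        intro x y w hx hy hw hwxy h1 h2 h4
        have h5 := mul_le_mul h1 h2 hy (hx.trans h1)
        have h6 : 0 ≤ r * (r - (4 / 3) ^ 2) := mul_nonneg hr0.le (by norm_num; linarith)
        have h7 := pow_le_pow_left₀ h6 h4 2
        refine le_of_mul_le_mul_left ?_ (pow_pos hr0 2)
        calc r ^ 2 * ((4 / 3) ^ 2 - r) ^ 2 = (r * (r - (4 / 3) ^ 2)) ^ 2 := by ring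
          _ ≤ 3 * (x * y) := by linarith
          _ ≤ _ := (mul_le_mul_of_nonneg_left h5 (by norm_num)).trans_eq (by ring)
      rcases le_total r 2.55 with h | h
      · refine aux 0.31 4.7 1.97 ?_ ?_ ?_ ?_ ?_ ?_ ?_ <;> try norm_num
        · rw [hX]; nlinarith [sq_nonneg (r - 50 / 21)]
        · norm_num at hY; rw [hY]; nlinarith [sq_nonneg (r - 2.24)]
        · nlinarith
      rcases le_total r 2.75 with h' | h'
      · refine aux 0.51 5.9 2.675 ?_ ?_ ?_ ?_ ?_ ?_ ?_ <;> try norm_num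
        · rw [hX]; nlinarith
        · norm_num at hY; rw [hY]; nlinarith
        · nlinarith
      · refine aux 1.2 8 3.67 ?_ ?_ ?_ ?_ ?_ ?_ ?_ <;> try norm_num
        · rw [hX]; nlinarith
        · norm_num at hY; rw [hY]; nlinarith
        · nlinarith
  · have hs : √r ^ 2 = r := Real.sq_sqrt hr0.le
    have hs0 : 0 ≤ √r := Real.sqrt_nonneg r
    -- Tangent to the square root at `r = 49 / 16`, just above the endpoint `3`.
    have hsr : √r ≤ 2 / 7 * r + 7 / 8 := by nlinarith [sq_nonneg (√r - 7 / 4)]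
    have hK2 : r + √r ≤ 2 * K := by
      have : r + (2 / 7 * r + 7 / 8) ≤ 2 * K := by
        refine le_of_mul_le_mul_right ?_ hr0
        nlinarith [mul_nonneg (sub_nonneg.2 h3) (sub_nonneg.2 h3)]
      linarith
    have h1 : 1 ≤ √r := by nlinarith
    have h4 : 0 < r * (2 * K - √r) - r := by nlinarith
    have h2 : 0 ≤ 2 * K - √r - r := by linarith
    refine ⟨√r, h1, by nlinarith, ?_, h2, by rwa [hs], ?_⟩
    · have : √r ^ 4 = r ^ 2 := by rw [← hs]; ring_nf; rw [hs]
      nlinarith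
    · rw [hs, sub_self]
      have := mul_nonneg h2 h4.le
      linarith

/-- Compare power series. The terms of degree `0` and `1` agree; those of degree at least `5` have
the right sign because `r ≤ c ^ 4` and `1 ≤ c`. Degrees `2`, `3`, `4` together form `c² t² / 24`
times a quadratic in `t`, nonnegative by `disc`. -/
lemma LaplaceParam.ineq {r K c : ℝ} (h : LaplaceParam r K c) {t : ℝ} (ht : 0 ≤ t) :
    c ^ 2 * (t + r * expRem t) ≤ c * (Real.exp (c * t) - 1)
      + (K - c) * (Real.exp (c * t) - 2 + Real.exp (-(c * t))) := by
  obtain ⟨h1, hK, hr, h2, h4, hdisc⟩ := h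
  set d := K - c with hd
  have hd0 : 0 ≤ d := sub_nonneg.2 hK
  have hexp : ∀ x : ℝ, HasSum (fun k : ℕ => x ^ k / (k.factorial : ℝ)) (Real.exp x) :=
    fun x => by
      have h := NormedSpace.expSeries_div_hasSum_exp (x : ℝ)
      rwa [← Real.exp_eq_exp_ℝ] at h
  have hsum := (((hexp (c * t)).mul_left (c + d)).add ((hexp (-(c * t))).mul_left d)).sub
    ((hexp t).mul_left (c ^ 2 * r))
  have hterm : ∀ k : ℕ, (c + d) * ((c * t) ^ k / (k.factorial : ℝ))
      + d * ((-(c * t)) ^ k / (k.factorial : ℝ)) - c ^ 2 * r * (t ^ k / (k.factorial : ℝ))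
      = (c ^ (k + 1) - c ^ 2 * r + d * (c ^ k + (-c) ^ k)) * (t ^ k / (k.factorial : ℝ)) := by
    intro k
    rw [← neg_mul, mul_pow, mul_pow]
    ring
  simp only [hterm] at hsum
  have hle := sum_le_hasSum (Finset.range 5) (fun k hk => ?_) hsum
  · simp only [Finset.sum_range_succ, Finset.sum_range_zero, Nat.factorial] at hle
    push_cast at hle
    have hquad : 0 ≤ 12 * (2 * K - c - r) + 4 * (c ^ 2 - r) * t
        + (c ^ 2 * (2 * K - c) - r) * t ^ 2 := by
      refine le_of_mul_le_mul_left ?_ h4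
      rw [mul_zero]
      nlinarith [sq_nonneg ((c ^ 2 * (2 * K - c) - r) * t + 2 * (c ^ 2 - r))]
    have hquad' := mul_nonneg (by positivity : 0 ≤ c ^ 2 * t ^ 2 / 24) hquad
    have hKd : K = c + d := by rw [hd]; ring
    rw [hKd] at hquad'
    unfold expRem
    nlinarith [hle, hquad']
  · have hk5 : 5 ≤ k := by simpa using hk
    have hcr : c ^ 2 * r ≤ c ^ (k + 1) := by
      calc c ^ 2 * r ≤ c ^ 2 * c ^ 4 := by gcongr
        _ = c ^ 6 := by ring
        _ ≤ c ^ (k + 1) := pow_le_pow_right₀ h1 (by omega)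
    have hpar : 0 ≤ c ^ k + (-c) ^ k := by
      have hc0 : 0 ≤ c := by linarith
      have h := neg_abs_le ((-c) ^ k)
      rw [abs_pow, abs_neg, abs_of_nonneg hc0] at h
      linarith
    have := mul_nonneg hd0 hpar
    exact mul_nonneg (by linarith) (by positivity)

end Laplace

section Laplace

variable {S : Type*} [MeasurableSpace S] {n : ℕ}
variable {ν : Measure S} [IsProbabilityMeasure ν] {Z : (Fin n → S) → ℝ}
  {D : Fin n → (Fin n → S) → ℝ}

/-- Exponential moments of weakly self-bounding functions, negative exponents, with
decrements normalized by `1`. -/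
lemma mgf_neg_le_of_le_one (hZ : IsBoundedMeasurable Z)
    (hDm : ∀ k, IsBoundedMeasurable (D k))
    (hD : ∀ k x y, Z x - Z (Function.update x k y) ≤ D k x) (hD1 : ∀ k x, D k x ≤ 1)
    {r : ℝ} (hr : 2 ≤ r) (hDr : ∀ x, ∑ k, D k x ^ 2 ≤ r * Z x) {s : ℝ} (hs : 0 < s) :
    mgf Z (Measure.pi fun _ : Fin n => ν) (-s) ≤
      Real.exp (-((∫ x, Z x ∂Measure.pi (fun _ => ν)) / (1 / s + (4 * r - 16 + 20 / r)))) := by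
  obtain ⟨c, hc⟩ := exists_laplaceParam hr
  set K := 4 * r - 16 + 20 / r with hK
  set P := Measure.pi fun _ : Fin n => ν with hP
  have hr0 : 0 < r := by linarith
  have hc0 : 0 < c := by linarith [hc.one_le]
  have hK0 : 0 < K := by linarith [hc.le_K]
  have hLpos : ∀ t, 0 < mgf Z P t := fun t => mgf_pos (hZ.integrable_exp P t)
  have hD0 : ∀ k x, 0 ≤ D k x := fun k x => by simpa using hD k x (x k)
  have hZ0 : ∀ x, 0 ≤ Z x := fun x => by
    have : 0 ≤ r * Z x := (Finset.sum_nonneg fun k _ => sq_nonneg (D k x)).trans (hDr x)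
    exact nonneg_of_mul_nonneg_right this hr0
  have hE : ∀ t, 0 < t → 0 < Real.exp (c * t) - 1 := fun t ht => by
    have := Real.add_one_lt_exp (mul_pos hc0 ht).ne'
    linarith [mul_pos hc0 ht]
  have hent : ∀ t, 0 < t → -t * (∫ x, Z x * Real.exp (-t * Z x) ∂P)
      - mgf Z P (-t) * cgf Z P (-t) ≤ r * expRem t * ∫ x, Z x * Real.exp (-t * Z x) ∂P := by
    intro t ht
    refine (entropy_exp_le (ν := ν) hZ hDm hD (-t)).trans ?_
    rw [← integral_const_mul]
    have hexp := hZ.comp_continuous (φ := fun z => Real.exp (-t * z)) (by fun_prop)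
    refine integral_mono (hexp.mul (IsBoundedMeasurable.sum _ fun k _ =>
      (hDm k).comp_continuous (φ := fun z => expRem (-(-t) * z))
        (by have := continuous_expRem; fun_prop))).integrable
      ((hZ.mul hexp).const_mul _).integrable fun x => ?_
    have h1 : ∑ k, expRem (-(-t) * D k x) ≤ ∑ k, D k x ^ 2 * expRem t :=
      Finset.sum_le_sum fun k _ => by
        rw [neg_neg]
        exact expRem_mul_le_sq_mul ht.le (hD0 k x) (hD1 k x)
    rw [← Finset.sum_mul] at h1
    have h2 := mul_le_mul_of_nonneg_right (hDr x) (expRem_nonneg t)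
    have h3 := mul_le_mul_of_nonneg_left (h1.trans h2) (Real.exp_pos (-t * Z x)).le
    refine h3.trans (le_of_eq ?_)
    ring
  have hH0 : ∀ t, 0 ≤ t → cgf Z P (-t) ≤ 0 := by
    intro t ht
    refine Real.log_nonpos (hLpos _).le ?_
    have h := integral_mono (hZ.integrable_exp P (-t)) (integrable_const (1 : ℝ)) (fun x => by
      refine Real.exp_le_one_iff.2 ?_
      have := mul_nonneg ht (hZ0 x)
      linarith)
    simpa [mgf] using h
  have hHd : ∀ t, HasDerivAt (fun t => cgf Z P (-t))
      (-((∫ x, Z x * Real.exp (-t * Z x) ∂P) / mgf Z P (-t))) t := fun t => by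
    have := (hasDerivAt_cgf_of_bounded (ν := ν) hZ (-t)).comp t (hasDerivAt_neg t)
    rwa [mul_neg_one] at this
  have key := mul_le_of_deriv_nonpos (H := fun t => cgf Z P (-t))
    (y := fun t => K + c / (Real.exp (c * t) - 1))
    (y' := fun t => -(c ^ 2 * Real.exp (c * t)) / (Real.exp (c * t) - 1) ^ 2)
    (h0 := -∫ x, Z x ∂P) (T := s + 1)
    (fun t _ _ => hHd t)
    (fun t ht _ => by
      have h1 : HasDerivAt (fun t => Real.exp (c * t) - 1) (Real.exp (c * t) * c) t := by
        have := ((hasDerivAt_id t).const_mul c).exp.sub_const 1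
        simpa using this
      have h2 := ((h1.inv (hE t ht).ne').const_mul c).const_add K
      refine (h2.congr_deriv ?_)
      ring)
    (fun t ht _ => by
      have h := hent t ht
      have hL := hLpos (-t)
      have hEt := hE t ht
      have hin := hc.ineq ht.le
      rw [Real.exp_neg] at hin
      generalize (∫ x, Z x * Real.exp (-t * Z x) ∂P) = I at h ⊢
      have hHt := hH0 t ht.le
      have hψ : 0 < t + r * expRem t := by
        have := mul_nonneg hr0.le (expRem_nonneg t); linarith
      have hexp := Real.exp_pos (c * t)
      generalize Real.exp (c * t) = E at *
      have hin' : c ^ 2 * (t + r * expRem t) * E ≤ (K * (E - 1) + c) * (E - 1) := by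
        have := mul_le_mul_of_nonneg_right hin hexp.le
        refine this.trans (le_of_eq ?_)
        field_simp
        ring
      -- The entropy bound reads `H' ≤ H / ψ` with `ψ = t + r * expRem t`. As `H ≤ 0`, it remains to
      -- show `-y' ≤ y / ψ`, which is `LaplaceParam.ineq` multiplied by `exp (c t)`.
      have hH' : -(I / mgf Z P (-t)) ≤ cgf Z P (-t) / (t + r * expRem t) := by
        rw [le_div_iff₀ hψ, neg_mul, div_mul_eq_mul_div, neg_le, ← sub_nonneg]
        have : I * (t + r * expRem t) / mgf Z P (-t) - -cgf Z P (-t)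
            = (r * expRem t * I - (-t * I - mgf Z P (-t) * cgf Z P (-t))) / mgf Z P (-t) := by
          field_simp
          ring
        rw [this]
        exact div_nonneg (by linarith) hL.le
      have hy : 0 ≤ K + c / (E - 1) := by positivity
      have hyψ : c ^ 2 * E / (E - 1) ^ 2 ≤ (K + c / (E - 1)) / (t + r * expRem t) := by
        rw [div_le_div_iff₀ (by positivity) hψ]
        refine le_trans (le_of_eq ?_) (hin'.trans (le_of_eq ?_))
        · ring
        · field_simp
      have h1 := mul_le_mul_of_nonneg_right hH' hy
      have h2 := mul_le_mul_of_nonneg_left hyψ (neg_nonneg.2 hHt)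
      have e : cgf Z P (-t) / (t + r * expRem t) * (K + c / (E - 1))
          = cgf Z P (-t) * ((K + c / (E - 1)) / (t + r * expRem t)) := by ring
      rw [e] at h1
      have e2 : cgf Z P (-t) * (-(c ^ 2 * E) / (E - 1) ^ 2)
          = -cgf Z P (-t) * (c ^ 2 * E / (E - 1) ^ 2) := by ring
      rw [e2]
      linarith)
    (by simp) (by simpa [mgf_zero] using hHd 0)
    (by
      have h1 : HasDerivAt (fun t => Real.exp (c * t)) c 0 := by
        have := ((hasDerivAt_id (0 : ℝ)).const_mul c).exp
        simpa using this
      have h2 := h1.tendsto_slope_zero_right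
      simp only [zero_add, mul_zero, Real.exp_zero, smul_eq_mul] at h2
      have h3 : Filter.Tendsto (fun t : ℝ => t * K) (nhdsWithin 0 (Set.Ioi 0)) (nhds 0) := by
        have : Continuous (fun t : ℝ => t * K) := by fun_prop
        simpa using (this.tendsto 0).mono_left nhdsWithin_le_nhds
      have h4 := h3.add ((h2.inv₀ hc0.ne').const_mul c)
      rw [mul_inv_cancel₀ hc0.ne', zero_add] at h4
      refine h4.congr' ?_
      filter_upwards [self_mem_nhdsWithin] with t ht
      have h0 : t ≠ 0 := (Set.mem_Ioi.1 ht).ne'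
      have h5 := (hE t ht).ne'
      field_simp)
    hs (lt_add_one s)
  rw [← exp_cgf (hZ.integrable_exp P (-s))]
  refine Real.exp_le_exp.2 ?_
  have hEZ : 0 ≤ ∫ x, Z x ∂P := integral_nonneg hZ0
  have hyK : K + c / (Real.exp (c * s) - 1) ≤ 1 / s + K := by
    have : c / (Real.exp (c * s) - 1) ≤ 1 / s := by
      rw [div_le_div_iff₀ (hE s hs) hs]
      linarith [Real.add_one_le_exp (c * s)]
    linarith
  have hypos : 0 < K + c / (Real.exp (c * s) - 1) := by
    have := div_pos hc0 (hE s hs); linarith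
  have h1 : (∫ x, Z x ∂P) / (1 / s + K) ≤ (∫ x, Z x ∂P) / (K + c / (Real.exp (c * s) - 1)) :=
    div_le_div_of_nonneg_left hEZ hypos hyK
  have h2 : (∫ x, Z x ∂P) / (K + c / (Real.exp (c * s) - 1)) ≤ -cgf Z P (-s) := by
    rw [div_le_iff₀ hypos]
    linarith
  linarith

/-- Exponential moments of weakly self-bounding functions, negative exponents. -/
lemma mgf_neg_le_of_selfBounding (hZ : IsBoundedMeasurable Z)
    (hDm : ∀ k, IsBoundedMeasurable (D k))
    (hD : ∀ k x y, Z x - Z (Function.update x k y) ≤ D k x) {m c : ℝ} (hm : 0 < m)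
    (hDle : ∀ k x, D k x ≤ m) (hc : 2 * m ≤ c) (hDc : ∀ x, ∑ k, D k x ^ 2 ≤ c * Z x)
    {s : ℝ} (hs : 0 < s) :
    mgf Z (Measure.pi fun _ : Fin n => ν) (-s) ≤
      Real.exp (-((∫ x, Z x ∂Measure.pi (fun _ => ν))
        / (1 / s + (4 * c - 16 * m + 20 * m ^ 2 / c)))) := by
  have hc0 : 0 < c := by linarith
  -- Dividing `Z` and `D` by `m` normalizes the decrements and turns `c` into `c / m` and `s` into
  -- `m s`.
  have h := mgf_neg_le_of_le_one (ν := ν) (Z := fun x => m⁻¹ * Z x)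
    (D := fun k x => m⁻¹ * D k x) (hZ.const_mul _) (fun k => (hDm k).const_mul _)
    (fun k x y => by rw [← mul_sub]; exact mul_le_mul_of_nonneg_left (hD k x y) (by positivity))
    (fun k x => by rw [inv_mul_le_iff₀ hm]; simpa using hDle k x)
    (r := c / m) (by rwa [le_div_iff₀ hm])
    (fun x => by
      simp only [mul_pow]
      rw [← Finset.mul_sum]
      refine (mul_le_mul_of_nonneg_left (hDc x) (by positivity)).trans_eq ?_
      field_simp) (s := m * s) (by positivity)
  have e : mgf (fun x => m⁻¹ * Z x) (Measure.pi fun _ : Fin n => ν) (-(m * s))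
      = mgf Z (Measure.pi fun _ : Fin n => ν) (-s) := by
    unfold mgf
    congr 1 with x
    field_simp
  rw [e, integral_const_mul] at h
  refine h.trans_eq ?_
  congr 2
  generalize (∫ x, Z x ∂Measure.pi (fun _ => ν)) = I
  have : 1 / (m * s) + (4 * (c / m) - 16 + 20 / (c / m))
      = m⁻¹ * (1 / s + (4 * c - 16 * m + 20 * m ^ 2 / c)) := by
    field_simp
  rw [this, mul_div_mul_left _ _ (by positivity)]

end Laplace

/-! ### Chernoff bounds for the square root -/

section Tail

variable {Ω : Type*} [MeasurableSpace Ω] {P : Measure Ω} [IsProbabilityMeasure P] {Z : Ω → ℝ}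

/-- Deviations of `√Z` below `√(E Z)`. -/
lemma measureReal_sqrt_lt_le (hint : ∀ s, Integrable (fun ω => Real.exp (s * Z ω)) P)
    {κ e : ℝ} (hκ : 0 < κ) (he : 0 ≤ e)
    (hmgf : ∀ s, 0 < s → mgf Z P (-s) ≤ Real.exp (-(e / (1 / s + κ)))) {t : ℝ} (ht : 0 ≤ t) :
    P.real {ω | √(Z ω) < √e - t} ≤ Real.exp (-(t ^ 2 / κ)) := by
  rcases ht.eq_or_lt with rfl | ht
  · simp
  set u := √e with hu
  have hu2 : u ^ 2 = e := Real.sq_sqrt he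
  rcases le_or_gt (u - t) 0 with hw | hw
  · have : {ω | √(Z ω) < u - t} = ∅ := by
      ext ω
      simp only [Set.mem_ofPred_eq, Set.mem_empty_iff_false, iff_false, not_lt]
      exact hw.trans (Real.sqrt_nonneg _)
    rw [this]
    simp [Real.exp_nonneg]
  set w := u - t with hwdef
  -- The optimal exponent: `1 / s + κ = κ u / t`, so the total exponent is `t w / κ - t u / κ = -t²
  -- / κ`.
  have hs : 0 < t / (w * κ) := by positivity
  have h1 : P.real {ω | √(Z ω) < w} ≤ P.real {ω | Z ω ≤ w ^ 2} :=
    measureReal_mono fun ω hω => ((Real.sqrt_lt' hw).1 hω).le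
  have h2 := measure_le_le_exp_mul_mgf (X := Z) (μ := P) (w ^ 2) (t := -(t / (w * κ)))
    (by linarith) (hint _)
  refine (h1.trans h2).trans ?_
  refine (mul_le_mul_of_nonneg_left (hmgf _ hs) (Real.exp_pos _).le).trans_eq ?_
  rw [← Real.exp_add]
  congr 1
  have hut : u = w + t := by rw [hwdef]; ring
  rw [← hu2, hut]
  have : w + t ≠ 0 := by positivity
  have e1 : 1 / (t / (w * κ)) + κ = κ * (w + t) / t := by field_simp
  rw [e1]
  field_simp
  ring

/-- Deviations of `√Z` above `√(E Z)`. -/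
lemma measureReal_lt_sqrt_le (hint : ∀ s, Integrable (fun ω => Real.exp (s * Z ω)) P)
    (hZ0 : ∀ ω, 0 ≤ Z ω) (hZint : Integrable Z P) {κ : ℝ} (hκ : 0 < κ)
    (hmgf : ∀ s, 0 < s → s < 1 / κ → mgf Z P s ≤ Real.exp ((∫ ω, Z ω ∂P) / (1 / s - κ)))
    {t : ℝ} (ht : 0 ≤ t) :
    P.real {ω | √(∫ ω, Z ω ∂P) + t < √(Z ω)} ≤ Real.exp (-(t ^ 2 / κ)) := by
  rcases ht.eq_or_lt with rfl | ht
  · simp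
  have he : 0 ≤ ∫ ω, Z ω ∂P := integral_nonneg hZ0
  rcases he.eq_or_lt with h0 | h0
  · have hae := (integral_eq_zero_iff_of_nonneg hZ0 hZint).1 h0.symm
    have : P.real {ω | √(∫ ω, Z ω ∂P) + t < √(Z ω)} = 0 := by
      rw [measureReal_eq_zero_iff]
      refine measure_mono_null ?_ hae
      intro ω hω h
      simp only [Set.mem_ofPred_eq] at hω
      rw [h, ← h0] at hω
      simp at hω
      linarith
    rw [this]
    exact (Real.exp_pos _).le
  generalize (∫ ω, Z ω ∂P) = e at *
  set u := √e with hu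
  have hu2 : u ^ 2 = e := Real.sq_sqrt he
  have hu0 : 0 < u := Real.sqrt_pos.2 h0
  set w := u + t with hwdef
  have hw : 0 < w := by positivity
  -- Here `1 / s - κ = κ u / t`, and `s < 1 / κ` because `t < w`; this needs `u > 0`, hence the
  -- separate case of zero mean.
  have hs : 0 < t / (w * κ) := by positivity
  have h1 : P.real {ω | w < √(Z ω)} ≤ P.real {ω | w ^ 2 ≤ Z ω} :=
    measureReal_mono fun ω hω => ((Real.lt_sqrt hw.le).1 hω).le
  have h2 := measure_ge_le_exp_mul_mgf (X := Z) (μ := P) (w ^ 2) (t := t / (w * κ))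
    hs.le (hint _)
  refine (h1.trans h2).trans ?_
  have hs1 : t / (w * κ) < 1 / κ := by
    rw [div_lt_div_iff₀ (by positivity) hκ]
    nlinarith
  refine (mul_le_mul_of_nonneg_left (hmgf _ hs hs1) (Real.exp_pos _).le).trans_eq ?_
  rw [← Real.exp_add]
  congr 1
  have e1 : 1 / (t / (w * κ)) - κ = κ * u / t := by
    rw [hwdef]; field_simp; ring
  rw [← hu2, e1, hwdef]
  field_simp
  ring

end Tail

/-! ### Pointwise difference bounds from the seminorms -/

section Seminorms

variable {S : Type*} {n : ℕ} {f : (Fin n → S) → ℝ}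

/-- All first differences of `f` are at most `A`. -/
def FirstDiffLE (f : (Fin n → S) → ℝ) (A : ℝ) : Prop :=
  ∀ k y y' x, partialDiff k y y' f x ≤ A

/-- All second differences of `f` in distinct coordinates are at most `ε`. -/
def SecondDiffLE (f : (Fin n → S) → ℝ) (ε : ℝ) : Prop :=
  ∀ l k, l ≠ k → ∀ z z' y y' x, partialDiff l z z' (partialDiff k y y' f) x ≤ ε

lemma FirstDiffLE.abs_partialDiff_le {A : ℝ} (h : FirstDiffLE f A) (k y y' x) :
    |partialDiff k y y' f x| ≤ A := by
  refine abs_le.2 ⟨?_, h k y y' x⟩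
  have := h k y' y x
  unfold partialDiff at *
  linarith

lemma SecondDiffLE.abs_partialDiff_le {ε : ℝ} (h : SecondDiffLE f ε) {l k} (hlk : l ≠ k) (z z' y y' x) :
    |partialDiff l z z' (partialDiff k y y' f) x| ≤ ε := by
  refine abs_le.2 ⟨?_, h l k hlk z z' y y' x⟩
  have := h l k hlk z' z y y' x
  unfold partialDiff at *
  linarith

/-- Boundedness of `f` is essential: the real supremum of an unbounded set is `0` by convention. -/
lemma HasWeakInteractions.firstDiffLE {a b : ℝ} (hf : ∃ C, ∀ x, |f x| ≤ C)
    (h : HasWeakInteractions a b f) : FirstDiffLE f (a / n) := by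
  obtain ⟨C, hC⟩ := hf
  intro k y y' x
  refine le_trans ?_ h.1
  refine le_ciSup (f := fun p : Fin n × (Fin n → S) × S × S =>
    partialDiff p.1 p.2.2.1 p.2.2.2 f p.2.1) ⟨2 * C, ?_⟩ (k, x, y, y')
  rintro _ ⟨p, rfl⟩
  have h1 := abs_le.1 (hC (Function.update p.2.1 p.1 p.2.2.1))
  have h2 := abs_le.1 (hC (Function.update p.2.1 p.1 p.2.2.2))
  simp only [partialDiff]
  linarith

lemma HasWeakInteractions.secondDiffLE {a b : ℝ} (hn : 0 < n) (hf : ∃ C, ∀ x, |f x| ≤ C)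
    (h : HasWeakInteractions a b f) : SecondDiffLE f (b / n ^ 2) := by
  obtain ⟨C, hC⟩ := hf
  have hn' : (0 : ℝ) < n := by exact_mod_cast hn
  intro l k hlk z z' y y' x
  have hJ := h.2
  unfold seminormJ at hJ
  rw [← le_div_iff₀' hn', div_div, ← pow_two] at hJ
  refine le_trans ?_ hJ
  refine le_ciSup (f := fun p : {lk : Fin n × Fin n // lk.1 ≠ lk.2} × (Fin n → S) × (S × S)
      × (S × S) => partialDiff p.1.1.1 p.2.2.1.1 p.2.2.1.2
        (partialDiff p.1.1.2 p.2.2.2.1 p.2.2.2.2 f) p.2.1) ⟨4 * C, ?_⟩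
    (⟨(l, k), hlk⟩, x, (z, z'), (y, y'))
  rintro _ ⟨p, rfl⟩
  simp only [partialDiff]
  have h1 := fun x => abs_le.1 (hC x)
  have := h1 (Function.update (Function.update p.2.1 p.1.1.1 p.2.2.1.1) p.1.1.2 p.2.2.2.1)
  have := h1 (Function.update (Function.update p.2.1 p.1.1.1 p.2.2.1.1) p.1.1.2 p.2.2.2.2)
  have := h1 (Function.update (Function.update p.2.1 p.1.1.1 p.2.2.1.2) p.1.1.2 p.2.2.2.1)
  have := h1 (Function.update (Function.update p.2.1 p.1.1.1 p.2.2.1.2) p.1.1.2 p.2.2.2.2)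
  linarith

end Seminorms

/-! ### A Schur test for pair weights -/

section Weights

variable {n : ℕ}

/-- The weight of the pair `(i, j)` in the bound on the decrement in the coordinate `k`. -/
noncomputable def pairWeight (A ε : ℝ) (k i j : Fin (n + 1)) : ℝ :=
  if i = j then 0 else
    ε + (A / 2 - ε) * ((if k = i then 1 else 0) + (if k = j then 1 else 0))

variable {A ε : ℝ}

lemma pairWeight_nonneg (hA : 0 ≤ A) (hε : 0 ≤ ε) (k i j : Fin (n + 1)) :
    0 ≤ pairWeight A ε k i j := by
  unfold pairWeight
  split_ifs with h1 h2 h3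
  · rfl
  · exact absurd (h2.symm.trans h3) h1
  all_goals linarith

/-- Off the diagonal, `k = i` and `k = j` contribute `A / 2` each and the other `n - 1` indices
contribute `ε`. -/
lemma sum_pairWeight_le (hA : 0 ≤ A) (hε : 0 ≤ ε) (hn : 1 ≤ n) (i j : Fin (n + 1)) :
    ∑ k, pairWeight A ε k i j ≤ A + (n - 1) * ε := by
  have hn' : (1 : ℝ) ≤ n := by exact_mod_cast hn
  unfold pairWeight
  by_cases h : i = j
  · simp only [h, if_true, Finset.sum_const_zero]
    have := mul_nonneg (sub_nonneg.2 hn') hε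
    linarith
  · simp only [h, if_false, Finset.sum_add_distrib, ← Finset.mul_sum]
    simp
    linarith

/-- Among the off-diagonal ordered pairs, `2 n` contain `k` and `n (n - 1)` do not. -/
lemma sum_sum_pairWeight (k : Fin (n + 1)) :
    ∑ p : Fin (n + 1) × Fin (n + 1), pairWeight A ε k p.1 p.2 = n * (A + (n - 1) * ε) := by
  have h : ∀ i j : Fin (n + 1), pairWeight A ε k i j
      = (ε + (A / 2 - ε) * ((if k = i then 1 else 0) + (if k = j then 1 else 0)))
        - if i = j then ε + (A / 2 - ε) * ((if k = i then 1 else 0) + (if k = i then 1 else 0))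
          else 0 := by
    intro i j
    unfold pairWeight
    by_cases hij : i = j
    · subst hij; simp
    · simp [hij]
  rw [Fintype.sum_prod_type]
  simp only [h, Finset.sum_sub_distrib, Finset.sum_add_distrib, ← Finset.mul_sum,
    Finset.sum_ite_eq, Finset.sum_const, Finset.mem_univ, if_true, Finset.card_univ,
    Fintype.card_fin, nsmul_eq_mul, mul_add]
  push_cast
  ring

/-- A weighted sum over the pairs, which bounds a decrement in the coordinate `k`. -/
noncomputable def pairSum (A ε : ℝ) (Δ : Fin (n + 1) → Fin (n + 1) → ℝ) (k : Fin (n + 1)) : ℝ :=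
  ∑ p : Fin (n + 1) × Fin (n + 1), pairWeight A ε k p.1 p.2 * |Δ p.1 p.2|

lemma pairSum_le (hA : 0 ≤ A) (hε : 0 ≤ ε) {Δ : Fin (n + 1) → Fin (n + 1) → ℝ}
    (hΔ : ∀ i j, |Δ i j| ≤ A) (k : Fin (n + 1)) :
    pairSum A ε Δ k ≤ n * (A + (n - 1) * ε) * A := by
  rw [← sum_sum_pairWeight k, Finset.sum_mul]
  exact Finset.sum_le_sum fun p _ =>
    mul_le_mul_of_nonneg_left (hΔ _ _) (pairWeight_nonneg hA hε _ _ _)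

/-- A Schur test for the kernel `pairWeight`. -/
lemma sum_pairSum_sq_le (hA : 0 ≤ A) (hε : 0 ≤ ε) (hn : 1 ≤ n)
    (Δ : Fin (n + 1) → Fin (n + 1) → ℝ) :
    ∑ k, pairSum A ε Δ k ^ 2 ≤
      n * (A + (n - 1) * ε) ^ 2 * ∑ p : Fin (n + 1) × Fin (n + 1), Δ p.1 p.2 ^ 2 := by
  have hn' : (1 : ℝ) ≤ n := by exact_mod_cast hn
  have hB : 0 ≤ A + (n - 1) * ε := by
    have := mul_nonneg (sub_nonneg.2 hn') hε; linarith
  calc ∑ k, pairSum A ε Δ k ^ 2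
      ≤ ∑ k, n * (A + (n - 1) * ε)
        * ∑ p : Fin (n + 1) × Fin (n + 1), pairWeight A ε k p.1 p.2 * Δ p.1 p.2 ^ 2 := by
        refine Finset.sum_le_sum fun k _ => ?_
        rw [← sum_sum_pairWeight k]
        -- Cauchy-Schwarz with the factors `w` and `w Δ²`, where `w` is the pair weight.
        refine Finset.sum_sq_le_sum_mul_sum_of_sq_le_mul _
          (fun p _ => pairWeight_nonneg hA hε _ _ _)
          (fun p _ => mul_nonneg (pairWeight_nonneg hA hε _ _ _) (sq_nonneg _)) fun p _ => ?_
        rw [mul_pow, sq_abs, pow_two, mul_assoc]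
    _ = n * (A + (n - 1) * ε) * ∑ p : Fin (n + 1) × Fin (n + 1),
        (∑ k, pairWeight A ε k p.1 p.2) * Δ p.1 p.2 ^ 2 := by
        rw [← Finset.mul_sum, Finset.sum_comm]
        simp only [Finset.sum_mul]
    _ ≤ n * (A + (n - 1) * ε) * ∑ p : Fin (n + 1) × Fin (n + 1),
        (A + (n - 1) * ε) * Δ p.1 p.2 ^ 2 := by
        refine mul_le_mul_of_nonneg_left (Finset.sum_le_sum fun p _ => ?_) (by positivity)
        exact mul_le_mul_of_nonneg_right (sum_pairWeight_le hA hε hn _ _) (sq_nonneg _)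
    _ = _ := by rw [← Finset.mul_sum]; ring

end Weights

/-! ### The variance estimator: decrements and mean -/

section Estimator

variable {S : Type*} {n : ℕ} {f : (Fin n → S) → ℝ}

/-- The change of `f`, evaluated at `x` without its `j`-th component, when the `i`-th component
is replaced by the `j`-th one. -/
def pairDiff (f : (Fin n → S) → ℝ) (x : Fin (n + 1) → S) (i j : Fin (n + 1)) : ℝ :=
  f (Fin.removeNth j x) - f (Fin.removeNth j (Function.update x i (x j)))

lemma pairDiff_self (x : Fin (n + 1) → S) (j : Fin (n + 1)) : pairDiff f x j j = 0 := by
  simp [pairDiff]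

lemma pairDiff_succAbove (x : Fin (n + 1) → S) (j : Fin (n + 1)) (i : Fin n) :
    pairDiff f x (j.succAbove i) j
      = f (Fin.removeNth j x) - f (Function.update (Fin.removeNth j x) i (x j)) := by
  rw [pairDiff, Fin.removeNth_update_succAbove]

lemma pairDiff_succAbove_eq_partialDiff (x : Fin (n + 1) → S) (j : Fin (n + 1)) (i : Fin n) :
    pairDiff f x (j.succAbove i) j
      = partialDiff i (x (j.succAbove i)) (x j) f (Fin.removeNth j x) := by
  rw [pairDiff_succAbove, partialDiff]
  congr 2
  exact (Function.update_eq_self i (Fin.removeNth j x)).symm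

lemma varEstimator_eq (f : (Fin n → S) → ℝ) (x : Fin (n + 1) → S) :
    varEstimator f x = 1 / (2 * ((n : ℝ) + 1)) *
      ∑ p : Fin (n + 1) × Fin (n + 1), pairDiff f x p.1 p.2 ^ 2 := by
  rw [varEstimator, Fintype.sum_prod_type_right]
  congr 1
  refine Finset.sum_congr rfl fun j _ => ?_
  rw [Finset.sum_filter]
  refine Finset.sum_congr rfl fun i _ => ?_
  by_cases h : i = j
  · subst h; simp [pairDiff_self]
  · simp [h, pairDiff]

lemma varEstimator_nonneg (f : (Fin n → S) → ℝ) (x : Fin (n + 1) → S) :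
    0 ≤ varEstimator f x := by
  rw [varEstimator_eq]
  positivity

lemma FirstDiffLE.abs_pairDiff_le {A : ℝ} (hA0 : 0 ≤ A) (hA : FirstDiffLE f A)
    (x : Fin (n + 1) → S) (i j : Fin (n + 1)) : |pairDiff f x i j| ≤ A := by
  by_cases h : i = j
  · subst h; simpa [pairDiff_self] using hA0
  · obtain ⟨i', rfl⟩ := Fin.exists_succAbove_eq h
    rw [pairDiff_succAbove_eq_partialDiff]
    exact hA.abs_partialDiff_le _ _ _ _

lemma SecondDiffLE.abs_pairDiff_sub_le {ε : ℝ} (hε : SecondDiffLE f ε)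
    (x : Fin (n + 1) → S) {i j k : Fin (n + 1)} (hij : i ≠ j) (hki : k ≠ i) (hkj : k ≠ j)
    (y : S) : |pairDiff f x i j - pairDiff f (Function.update x k y) i j| ≤ ε := by
  obtain ⟨i', rfl⟩ := Fin.exists_succAbove_eq hij
  obtain ⟨k', rfl⟩ := Fin.exists_succAbove_eq hkj
  have hki' : k' ≠ i' := fun h => hki (by rw [h])
  rw [pairDiff_succAbove_eq_partialDiff, pairDiff_succAbove_eq_partialDiff,
    Fin.removeNth_update_succAbove, Function.update_of_ne hki.symm, Function.update_of_ne hkj.symm]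
  have h := hε.abs_partialDiff_le hki' (x (j.succAbove k')) y (x (j.succAbove i')) (x j) (Fin.removeNth j x)
  unfold partialDiff at h ⊢
  have e : Function.update (Fin.removeNth j x) k' (x (j.succAbove k')) = Fin.removeNth j x :=
    Function.update_eq_self k' (Fin.removeNth j x)
  rwa [e] at h

/-- The decrements of the variance estimator. -/
lemma varEstimator_sub_le {A ε : ℝ} (hA0 : 0 ≤ A) (hA : FirstDiffLE f A)
    (hε : SecondDiffLE f ε) (k : Fin (n + 1)) (x : Fin (n + 1) → S) (y : S) :
    varEstimator f x - varEstimator f (Function.update x k y)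
      ≤ 1 / ((n : ℝ) + 1) * pairSum A ε (pairDiff f x) k := by
  have hn : (0 : ℝ) < (n : ℝ) + 1 := by positivity
  rw [varEstimator_eq, varEstimator_eq, ← mul_sub, ← Finset.sum_sub_distrib]
  have e : ∀ s : ℝ, 1 / (2 * ((n : ℝ) + 1)) * s = 1 / ((n : ℝ) + 1) * (s / 2) := fun s => by
    field_simp
  rw [e, Finset.sum_div]
  refine mul_le_mul_of_nonneg_left (Finset.sum_le_sum fun p _ => ?_) (by positivity)
  obtain ⟨i, j⟩ := p
  simp only [pairWeight]
  set d := pairDiff f x i j with hd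
  set d' := pairDiff f (Function.update x k y) i j with hd'
  by_cases hij : i = j
  · subst hij
    simp [hd, hd', pairDiff_self]
  have hdA : |d| ≤ A := hA.abs_pairDiff_le hA0 x i j
  have hdd : d ^ 2 ≤ A * |d| := by
    rw [← sq_abs, pow_two]; exact mul_le_mul_of_nonneg_right hdA (abs_nonneg _)
  rw [if_neg hij]
  by_cases hki : k = i
  · have hkj : k ≠ j := fun h => hij (hki.symm.trans h)
    rw [if_pos hki, if_neg hkj]
    -- If `k` belongs to the pair, `d'` is uncontrolled and `-d'²` is dropped: `d² - d'² ≤ d² ≤ A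
    -- |d|`.
    nlinarith [sq_nonneg d']
  by_cases hkj : k = j
  · rw [if_neg hki, if_pos hkj]
    nlinarith [sq_nonneg d']
  · rw [if_neg hki, if_neg hkj]
    have h := hε.abs_pairDiff_sub_le x hij hki hkj y
    have h1 : d * (d - d') ≤ |d| * ε := by
      refine (le_abs_self _).trans ?_
      rw [abs_mul]
      exact mul_le_mul_of_nonneg_left h (abs_nonneg _)
    -- If `k` is outside the pair, `d - d'` is a second difference, and `d² - d'² = 2 d (d - d') -
    -- (d - d')² ≤ 2 ε |d|`.
    nlinarith [sq_nonneg (d - d')]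

variable [MeasurableSpace S]

lemma measurable_removeNth (j : Fin (n + 1)) :
    Measurable (fun x : Fin (n + 1) → S => (Fin.removeNth j x : Fin n → S)) :=
  measurable_pi_lambda _ fun _ => measurable_pi_apply _

lemma IsBoundedMeasurable.pairDiff (hf : IsBoundedMeasurable f) (i j : Fin (n + 1)) :
    IsBoundedMeasurable (fun x => pairDiff f x i j) := by
  have hm : Measurable (fun x : Fin (n + 1) → S => Function.update x i (x j)) := by
    refine measurable_pi_lambda _ fun l => ?_
    by_cases h : l = i
    · subst h; simpa using measurable_pi_apply j
    · simpa [h] using measurable_pi_apply l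
  exact (hf.comp (measurable_removeNth j)).sub (hf.comp ((measurable_removeNth j).comp hm))

lemma IsBoundedMeasurable.varEstimator (hf : IsBoundedMeasurable f) :
    IsBoundedMeasurable (varEstimator f) := by
  have h : IsBoundedMeasurable (fun x => 1 / (2 * ((n : ℝ) + 1)) *
      ∑ p : Fin (n + 1) × Fin (n + 1), WeakInteractions.pairDiff f x p.1 p.2 ^ 2) :=
    (IsBoundedMeasurable.sum _ fun p _ => (hf.pairDiff p.1 p.2).sq).const_mul _
  rwa [← funext (varEstimator_eq f)] at h

lemma IsBoundedMeasurable.pairSum (hf : IsBoundedMeasurable f) (A ε : ℝ) (k : Fin (n + 1)) :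
    IsBoundedMeasurable (fun x => 1 / ((n : ℝ) + 1) *
      WeakInteractions.pairSum A ε (WeakInteractions.pairDiff f x) k) :=
  (IsBoundedMeasurable.sum _ fun p _ => (hf.pairDiff p.1 p.2).abs.const_mul _).const_mul _

variable {ν : Measure S} [IsProbabilityMeasure ν]

/-- The component `x j` is an independent copy of coordinate `i` of the remaining sample, and the
mean squared difference of two independent copies is twice the variance. -/
lemma integral_pairDiff_sq (hf : IsBoundedMeasurable f) (j : Fin (n + 1)) (i : Fin n) :
    ∫ x, pairDiff f x (j.succAbove i) j ^ 2 ∂Measure.pi (fun _ => ν)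
      = 2 * ∫ x, (f x - avg ν {i} f x) ^ 2 ∂Measure.pi (fun _ => ν) := by
  have hmp := measurePreserving_piFinSuccAbove (fun _ : Fin (n + 1) => ν) j
  set g : S × (Fin n → S) → ℝ := fun p => (f p.2 - f (Function.update p.2 i p.1)) ^ 2 with hg
  have hupd : Measurable (fun p : S × (Fin n → S) => Function.update p.2 i p.1) := by
    refine measurable_pi_lambda _ fun l => ?_
    by_cases h : l = i
    · subst h; simpa using measurable_fst
    · simp only [Function.update_of_ne h]
      exact (measurable_pi_apply l).comp measurable_snd
  obtain ⟨C, hC⟩ := hf.2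
  have hgi : Integrable g (ν.prod (Measure.pi fun _ : Fin n => ν)) := by
    refine Integrable.of_bound
      (((hf.1.comp measurable_snd).sub (hf.1.comp hupd)).pow_const 2).aestronglyMeasurable
      ((2 * C) ^ 2) (Filter.Eventually.of_forall fun p => ?_)
    have h1 := abs_le.1 (hC p.2)
    have h2 := abs_le.1 (hC (Function.update p.2 i p.1))
    rw [Real.norm_eq_abs, hg, abs_of_nonneg (sq_nonneg _)]
    exact sq_le_sq' (by linarith) (by linarith)
  have e1 : ∫ x, pairDiff f x (j.succAbove i) j ^ 2 ∂Measure.pi (fun _ => ν)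
      = ∫ p, g p ∂(ν.prod (Measure.pi fun _ : Fin n => ν)) := by
    rw [← hmp.integral_comp' g]
    simp only [pairDiff_succAbove, hg]
    rfl
  rw [e1, integral_prod_symm _ hgi, integral_sub_avg_sq hf]
  have hav := hf.avg (ν := ν) {i}
  have h2 : ∀ z, ∫ y, g (y, z) ∂ν
      = f z ^ 2 + avg ν {i} (fun x => f x ^ 2) z - 2 * (f z * avg ν {i} f z) := by
    intro z
    rw [avg_singleton hf, avg_singleton hf.sq]
    have hm : Measurable (fun y => f (Function.update z i y)) := hf.1.comp (measurable_update z)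
    have i1 : Integrable (fun y => f (Function.update z i y)) ν :=
      hf.integrable_comp (measurable_update z)
    have i2 : Integrable (fun y => f (Function.update z i y) ^ 2) ν :=
      hf.sq.integrable_comp (measurable_update z)
    have e : ∀ y, g (y, z) = f z ^ 2 + f (Function.update z i y) ^ 2
        - 2 * f z * f (Function.update z i y) := fun y => by simp only [hg]; ring
    simp only [e]
    have i3 : Integrable (fun y => f z ^ 2 + f (Function.update z i y) ^ 2) ν :=
      (integrable_const _).add i2
    rw [integral_sub i3 (i1.const_mul _), integral_add (integrable_const _) i2,
      integral_const_mul]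
    simp
    ring
  simp only [h2]
  have h3 : ∫ x, f x * avg ν {i} f x ∂Measure.pi (fun _ => ν)
      = ∫ x, avg ν {i} f x ^ 2 ∂Measure.pi (fun _ => ν) := by
    have := integral_mul_avg (ν := ν) hav hf {i} (fun x x' => avg_piecewise {i} f x x')
    simp only [pow_two]
    rw [this]
    simp only [mul_comm]
  rw [integral_sub (hf.sq.add (hf.sq.avg _)).integrable ((hf.mul hav).const_mul 2).integrable,
    integral_add hf.sq.integrable (hf.sq.avg _).integrable, integral_const_mul,
    integral_avg hf.sq, h3]
  ring

/-- The mean of the variance estimator is the Efron-Stein bound on the variance. -/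
lemma integral_varEstimator (hf : IsBoundedMeasurable f) :
    ∫ x, varEstimator f x ∂Measure.pi (fun _ => ν)
      = ∑ i, ∫ x, (f x - avg ν {i} f x) ^ 2 ∂Measure.pi (fun _ => ν) := by
  simp only [varEstimator_eq]
  rw [integral_const_mul, integral_finsetSum _ fun p _ => (hf.pairDiff p.1 p.2).sq.integrable,
    Fintype.sum_prod_type_right]
  have h : ∀ j : Fin (n + 1), ∑ i, ∫ x, pairDiff f x i j ^ 2 ∂Measure.pi (fun _ => ν)
      = 2 * ∑ i, ∫ x, (f x - avg ν {i} f x) ^ 2 ∂Measure.pi (fun _ => ν) := by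
    intro j
    rw [Fin.sum_univ_succAbove _ j]
    simp only [pairDiff_self, integral_pairDiff_sq hf, ← Finset.mul_sum]
    simp
  simp only [h]
  rw [Finset.sum_const, Finset.card_univ, Fintype.card_fin, nsmul_eq_mul]
  have : (0 : ℝ) < (n : ℝ) + 1 := by positivity
  push_cast
  field_simp

/-- The second order terms of the Efron-Stein deficit. -/
lemma SecondDiffLE.integral_sq_le {ε : ℝ} (hf : IsBoundedMeasurable f)
    (hε : SecondDiffLE f ε) {l k : Fin n} (hlk : l ≠ k) :
    ∫ x, ((f x - avg ν {k} f x) - avg ν {l} (fun x => f x - avg ν {k} f x) x) ^ 2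
        ∂Measure.pi (fun _ => ν) ≤ ε ^ 2 / 4 := by
  have hk := hf.avg (ν := ν) {k}
  have hhb := hf.sub hk
  set h : (Fin n → S) → ℝ := fun x => f x - avg ν {k} f x with hh
  have hlb := hhb.avg (ν := ν) {l}
  have hWb := (hhb.sub hlb).sq
  have hrange : ∀ x z z', h (Function.update x l z) - h (Function.update x l z') ≤ ε := by
    intro x z z'
    simp only [hh]
    rw [avg_singleton hf, avg_singleton hf]
    have i1 : ∀ z, Integrable (fun y => f (Function.update (Function.update x l z) k y)) ν :=
      fun z => hf.integrable_comp (measurable_update _)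
    have i3 : Integrable (fun y => f (Function.update (Function.update x l z) k y)
        - f (Function.update (Function.update x l z') k y)) ν := (i1 z).sub (i1 z')
    have h1 := integral_mono (integrable_const (f (Function.update x l z)
      - f (Function.update x l z') - ε)) i3 (fun y => by
        have := hε l k hlk z z' (x k) y x
        have e : ∀ z, Function.update (Function.update x l z) k (x k) = Function.update x l z := by
          intro z
          rw [Function.update_eq_iff]
          simp [Function.update_of_ne hlk.symm]
        simp only [partialDiff, e] at this
        linarith)
    rw [integral_sub (i1 z) (i1 z')] at h1
    simp at h1
    linarith
  rw [← integral_avg hWb {l}]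
  have hpt : ∀ x, avg ν {l} (fun x => (h x - avg ν {l} h x) ^ 2) x ≤ ε ^ 2 / 4 := by
    intro x
    have hconst : ∀ z, avg ν {l} h (Function.update x l z) = avg ν {l} h x := fun z => by
      have := avg_piecewise (ν := ν) {l} h x (fun _ => z)
      rwa [Finset.piecewise_singleton] at this
    rw [avg_singleton hWb]
    simp only [hconst]
    rw [avg_singleton hhb]
    have hm : Measurable (fun z => h (Function.update x l z)) := hhb.1.comp (measurable_update x)
    rw [← variance_eq_integral hm.aemeasurable]
    obtain ⟨C, hC⟩ := hhb.2
    have : Nonempty S := nonempty_of_isProbabilityMeasure ν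
    have hbdd : BddBelow (Set.range fun z => h (Function.update x l z)) := ⟨-C, by
      rintro _ ⟨z, rfl⟩; exact (abs_le.1 (hC _)).1⟩
    -- As a function of the coordinate `l`, `f - E_k f` has oscillation at most `ε`, so Popoviciu's
    -- inequality bounds its variance by `ε² / 4`.
    have hv := variance_le_sq_of_bounded (μ := ν) (X := fun z => h (Function.update x l z))
      (a := ⨅ z, h (Function.update x l z)) (b := (⨅ z, h (Function.update x l z)) + ε)
      (Filter.Eventually.of_forall fun z => ⟨ciInf_le hbdd z, by
        have : h (Function.update x l z) - ε ≤ ⨅ z, h (Function.update x l z) :=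
          le_ciInf fun z' => by linarith [hrange x z z']
        linarith⟩) hm.aemeasurable
    refine hv.trans_eq ?_
    ring
  have := integral_mono (hWb.avg (ν := ν) {l}).integrable
    (integrable_const (μ := Measure.pi fun _ : Fin n => ν) (ε ^ 2 / 4)) hpt
  simpa using this

end Estimator

/-! ### Concentration and bias of the estimator -/

section Concentration

variable {S : Type*} {n : ℕ} {f : (Fin n → S) → ℝ} {a b : ℝ}

lemma first_add_second_le (hn : 1 ≤ n) (hb : 0 ≤ b) :
    a / n + ((n : ℝ) - 1) * (b / n ^ 2) ≤ (a + b) / n := by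
  have hn' : (0 : ℝ) < n := by exact_mod_cast hn
  have : (a + b) / n - (a / n + ((n : ℝ) - 1) * (b / n ^ 2)) = b / n ^ 2 := by
    field_simp
    ring
  have h2 : 0 ≤ b / (n : ℝ) ^ 2 := by positivity
  linarith

/-- The bound on the decrement of the variance estimator in the coordinate `k`. -/
noncomputable def decrBound (f : (Fin n → S) → ℝ) (a b : ℝ) (k : Fin (n + 1))
    (x : Fin (n + 1) → S) : ℝ :=
  1 / ((n : ℝ) + 1) * pairSum (a / n) (b / n ^ 2) (pairDiff f x) k

lemma decrBound_le (hn : 1 ≤ n) (ha : 0 ≤ a) (hb : 0 ≤ b) (h1 : FirstDiffLE f (a / n))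
    (k : Fin (n + 1)) (x : Fin (n + 1) → S) :
    decrBound f a b k x ≤ a * (a + b) / (n * (n + 1)) := by
  have hn' : (0 : ℝ) < n := by exact_mod_cast hn
  have hA : 0 ≤ a / (n : ℝ) := by positivity
  have h := pairSum_le (ε := b / (n : ℝ) ^ 2) hA (by positivity)
    (h1.abs_pairDiff_le hA x) k
  have h2 := mul_le_mul_of_nonneg_right
    (mul_le_mul_of_nonneg_left (first_add_second_le (a := a) hn hb) hn'.le) hA
  refine (mul_le_mul_of_nonneg_left (h.trans h2) (by positivity)).trans_eq ?_
  field_simp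

lemma sum_decrBound_sq_le (hn : 1 ≤ n) (ha : 0 ≤ a) (hb : 0 ≤ b) (x : Fin (n + 1) → S) :
    ∑ k, decrBound f a b k x ^ 2 ≤ 2 * (a + b) ^ 2 / (n * (n + 1)) * varEstimator f x := by
  have hn' : (0 : ℝ) < n := by exact_mod_cast hn
  have hn1 : (1 : ℝ) ≤ n := by exact_mod_cast hn
  have hA : 0 ≤ a / (n : ℝ) := by positivity
  have hε : 0 ≤ b / (n : ℝ) ^ 2 := by positivity
  have h := sum_pairSum_sq_le hA hε hn (pairDiff f x)
  have h0 : 0 ≤ a / n + ((n : ℝ) - 1) * (b / n ^ 2) := by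
    have := mul_nonneg (sub_nonneg.2 hn1) hε; linarith
  have h2 := pow_le_pow_left₀ h0 (first_add_second_le (a := a) hn hb) 2
  have hV : 0 ≤ ∑ p : Fin (n + 1) × Fin (n + 1), pairDiff f x p.1 p.2 ^ 2 := by positivity
  have h3 := mul_le_mul_of_nonneg_right (mul_le_mul_of_nonneg_left h2 hn'.le) hV
  simp only [decrBound, mul_pow]
  rw [← Finset.mul_sum, varEstimator_eq]
  refine (mul_le_mul_of_nonneg_left (h.trans h3) (by positivity)).trans_eq ?_
  field_simp

variable [MeasurableSpace S] {ν : Measure S} [IsProbabilityMeasure ν]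

/-- Deviations of the root of the variance estimator below the root of its mean. -/
lemma measureReal_sqrt_varEstimator_lt_le (hf : IsBoundedMeasurable f) (hn : 1 ≤ n) (ha : 0 < a)
    (hb : 0 ≤ b) (h1 : FirstDiffLE f (a / n)) (h2 : SecondDiffLE f (b / n ^ 2)) {t : ℝ}
    (ht : 0 ≤ t) :
    (Measure.pi fun _ : Fin (n + 1) => ν).real {x | √(varEstimator f x)
        < √(∫ x, varEstimator f x ∂Measure.pi (fun _ => ν)) - t}
      ≤ Real.exp (-(t ^ 2 / ((2 * a ^ 2 + 8 * b ^ 2) / n ^ 2))) := by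
  have hn' : (0 : ℝ) < n := by exact_mod_cast hn
  have hA : 0 ≤ a / (n : ℝ) := by positivity
  set κ := (2 * a ^ 2 + 8 * b ^ 2) / ((n : ℝ) * (n + 1)) with hκdef
  have hκ : 0 < κ := by positivity
  have hV := hf.varEstimator
  refine (measureReal_sqrt_lt_le (P := Measure.pi fun _ : Fin (n + 1) => ν)
    (fun s => hV.integrable_exp _ s) hκ (integral_nonneg (varEstimator_nonneg f))
    (fun s hs => ?_) ht).trans ?_
  · refine (mgf_neg_le_of_selfBounding (ν := ν) hV (fun k => hf.pairSum (a / n) (b / n ^ 2) k)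
      (fun k x y => varEstimator_sub_le hA h1 h2 k x y)
      (m := a * (a + b) / (n * (n + 1))) (c := 2 * (a + b) ^ 2 / (n * (n + 1)))
      (by positivity) (decrBound_le hn ha.le hb h1) ?_
      (sum_decrBound_sq_le hn ha.le hb) hs).trans_eq ?_
    · rw [← mul_div_assoc]
      refine div_le_div_of_nonneg_right ?_ (by positivity)
      nlinarith [mul_nonneg ha.le hb]
    -- Here `4 c - 16 m + 20 m² / c` equals `(2 a² + 8 b²) / (n (n + 1))` exactly: the `a b` terms
    -- cancel.
    · congr 4
      rw [hκdef]
      have : a + b ≠ 0 := by positivity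
      field_simp
      ring
  · refine Real.exp_le_exp.2 (neg_le_neg ?_)
    refine div_le_div_of_nonneg_left (by positivity) hκ ?_
    refine div_le_div_of_nonneg_left (by positivity) (by positivity) ?_
    nlinarith

/-- Deviations of the root of the variance estimator above the root of its mean. -/
lemma measureReal_lt_sqrt_varEstimator_le (hf : IsBoundedMeasurable f) (hn : 1 ≤ n) (ha : 0 < a)
    (hb : 0 ≤ b) (h1 : FirstDiffLE f (a / n)) (h2 : SecondDiffLE f (b / n ^ 2)) {t : ℝ}
    (ht : 0 ≤ t) :
    (Measure.pi fun _ : Fin (n + 1) => ν).real {x |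
        √(∫ x, varEstimator f x ∂Measure.pi (fun _ => ν)) + t < √(varEstimator f x)}
      ≤ Real.exp (-(t ^ 2 / ((2 * a ^ 2 + 8 * b ^ 2) / n ^ 2))) := by
  have hn' : (0 : ℝ) < n := by exact_mod_cast hn
  have hA : 0 ≤ a / (n : ℝ) := by positivity
  set κ := (a + b) ^ 2 / ((n : ℝ) * (n + 1)) with hκdef
  have hκ : 0 < κ := by positivity
  have hV := hf.varEstimator
  have hc : 2 * (a + b) ^ 2 / ((n : ℝ) * (n + 1)) = 2 * κ := by rw [hκdef]; ring
  refine (measureReal_lt_sqrt_le (P := Measure.pi fun _ : Fin (n + 1) => ν)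
    (fun s => hV.integrable_exp _ s) (varEstimator_nonneg f) hV.integrable hκ
    (fun s hs hs1 => ?_) ht).trans ?_
  · refine (mgf_le_of_selfBounding (ν := ν) hV (fun k => hf.pairSum (a / n) (b / n ^ 2) k)
      (fun k x y => varEstimator_sub_le hA h1 h2 k x y)
      (c := 2 * (a + b) ^ 2 / (n * (n + 1))) (by positivity)
      (sum_decrBound_sq_le hn ha.le hb) hs ?_).trans_eq ?_
    · rw [hc, ← div_div, div_self two_ne_zero]; exact hs1
    · rw [hc, mul_div_cancel_left₀ _ two_ne_zero]
  · refine Real.exp_le_exp.2 (neg_le_neg ?_)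
    refine div_le_div_of_nonneg_left (by positivity) hκ ?_
    refine div_le_div₀ (by positivity) ?_ (by positivity) (by nlinarith)
    nlinarith [sq_nonneg (a - b), sq_nonneg b]

/-- Both deviation bounds, with the radius in terms of the confidence level. -/
lemma sqrt_varEstimator_deviation (hf : IsBoundedMeasurable f) (hn : 1 ≤ n) (ha : 0 ≤ a)
    (hb : 0 ≤ b) (h1 : FirstDiffLE f (a / n)) (h2 : SecondDiffLE f (b / n ^ 2)) {L : ℝ}
    (hL : 0 ≤ L) :
    (Measure.pi fun _ : Fin (n + 1) => ν).real {x | √(varEstimator f x)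
        < √(∫ x, varEstimator f x ∂Measure.pi (fun _ => ν)) - Kplus a b / n * √L}
      ≤ Real.exp (-L) ∧
    (Measure.pi fun _ : Fin (n + 1) => ν).real {x |
        √(∫ x, varEstimator f x ∂Measure.pi (fun _ => ν)) + Kplus a b / n * √L
          < √(varEstimator f x)} ≤ Real.exp (-L) := by
  have hn' : (0 : ℝ) < n := by exact_mod_cast hn
  have hs : 0 ≤ Kplus a b / n * √L := by unfold Kplus; positivity
  rcases ha.eq_or_lt with rfl | ha
  -- For `a = 0` all first differences vanish, so the estimator is identically zero; the entropy
  -- argument needs `m > 0`.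
  · have hV : ∀ x, varEstimator f x = 0 := fun x => by
      have h : ∀ i j, pairDiff f x i j = 0 := fun i j => by
        have := h1.abs_pairDiff_le (by simp) x i j
        simpa using this
      simp [varEstimator_eq, h]
    have e1 : ¬ (0 < -(Kplus 0 b / n * √L)) := by linarith
    have e2 : ¬ (Kplus 0 b / n * √L < 0) := by linarith
    simp only [hV, integral_zero, Real.sqrt_zero, zero_sub, zero_add, e1, e2]
    simp [Real.exp_nonneg]
  · have hK : 0 < 2 * a ^ 2 + 8 * b ^ 2 := by positivity
    have e : (Kplus a b / n * √L) ^ 2 / ((2 * a ^ 2 + 8 * b ^ 2) / (n : ℝ) ^ 2) = L := by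
      rw [mul_pow, div_pow, Real.sq_sqrt hL, Kplus, Real.sq_sqrt hK.le]
      field_simp
    constructor
    · have h := measureReal_sqrt_varEstimator_lt_le (ν := ν) hf hn ha hb h1 h2 hs
      rwa [e] at h
    · have h := measureReal_lt_sqrt_varEstimator_le (ν := ν) hf hn ha hb h1 h2 hs
      rwa [e] at h

lemma variance_pi_eq (hf : IsBoundedMeasurable f) :
    variance f (Measure.pi fun _ : Fin n => ν)
      = ∫ x, (f x - avg ν Finset.univ f x) ^ 2 ∂Measure.pi (fun _ => ν) := by
  rw [variance_eq_integral hf.1.aemeasurable]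
  simp only [avg_univ]

lemma variance_le_integral_varEstimator (hf : IsBoundedMeasurable f) :
    variance f (Measure.pi fun _ : Fin n => ν)
      ≤ ∫ x, varEstimator f x ∂Measure.pi (fun _ => ν) := by
  rw [variance_pi_eq hf, integral_varEstimator hf]
  exact integral_sub_avg_sq_le hf _

/-- Each of the `n (n - 1) / 2` unordered pairs of coordinates costs at most `(b / n²)² / 4`. -/
lemma integral_varEstimator_le (hf : IsBoundedMeasurable f) (hn : 1 ≤ n)
    (h2 : SecondDiffLE f (b / n ^ 2)) :
    ∫ x, varEstimator f x ∂Measure.pi (fun _ => ν)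
      ≤ variance f (Measure.pi fun _ : Fin n => ν) + b ^ 2 / (8 * n ^ 2) := by
  have hn' : (0 : ℝ) < n := by exact_mod_cast hn
  rw [variance_pi_eq hf, integral_varEstimator hf]
  refine (sum_integral_sub_avg_sq_le hf (fun k l hlk => h2.integral_sq_le hf hlk)
    Finset.univ).trans ?_
  rw [Finset.card_univ, Fintype.card_fin]
  refine add_le_add le_rfl ?_
  have e : b ^ 2 / (8 * (n : ℝ) ^ 2) - (n : ℝ) * ((n : ℝ) - 1) / 2 * ((b / n ^ 2) ^ 2 / 4)
      = b ^ 2 / (8 * n ^ 3) := by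
    field_simp
    ring
  have : 0 ≤ b ^ 2 / (8 * (n : ℝ) ^ 3) := by positivity
  linarith

end Concentration

/-- Union bound for `A ∪ B`, so neither event has to be measurable. -/
lemma one_sub_le_of_compl_subset {Ω : Type*} [MeasurableSpace Ω] {P : Measure Ω}
    [IsProbabilityMeasure P] {A B : Set Ω} {δ : ℝ} (h : Aᶜ ⊆ B) (hB : P.real B ≤ δ) :
    1 - δ ≤ P.real A := by
  have h1 : P.real (A ∪ B) = 1 := by
    have : A ∪ B = Set.univ := by
      rw [Set.eq_univ_iff_forall]
      intro ω
      by_cases hω : ω ∈ A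
      · exact Or.inl hω
      · exact Or.inr (h hω)
    rw [this]; simp
  have h2 := measureReal_union_le (μ := P) A B
  linarith

end WeakInteractions

/-! ### Confidence bounds for the standard deviation -/

theorem corollary2 {S Ω : Type*} [MeasurableSpace S] [MeasurableSpace Ω]
    (P : Measure Ω) [IsProbabilityMeasure P] (n : ℕ) (hn : 2 ≤ n)
    (X : Fin (n + 1) → Ω → S) (hX : ∀ i, Measurable (X i)) (hindep : iIndepFun X P)
    (hident : ∀ i j, IdentDistrib (X i) (X j) P P)
    (f : (Fin n → S) → ℝ) (hf : WeakInteractions.IsBoundedMeasurable f)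
    (a b : ℝ) (hab : WeakInteractions.HasWeakInteractions a b f)
    (δ : ℝ) (hδ0 : 0 < δ) (hδ1 : δ < 1) :
    -- the two-sided bound
    1 - δ ≤ P.real {ω |
        √(WeakInteractions.varEstimator f (fun i => X i ω))
            - WeakInteractions.Kminus a b / n * √(Real.log (2 / δ))
          ≤ WeakInteractions.stdDev P X f ∧
        WeakInteractions.stdDev P X f
          ≤ √(WeakInteractions.varEstimator f (fun i => X i ω))
            + WeakInteractions.Kplus a b / n * √(Real.log (2 / δ))} ∧
    -- the one-sided upper bound
    1 - δ ≤ P.real {ω |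
        WeakInteractions.stdDev P X f
          ≤ √(WeakInteractions.varEstimator f (fun i => X i ω))
            + WeakInteractions.Kplus a b / n * √(Real.log (1 / δ))} ∧
    -- the one-sided lower bound
    (δ ≤ Real.exp (-1) →
      1 - δ ≤ P.real {ω |
        √(WeakInteractions.varEstimator f (fun i => X i ω))
            - WeakInteractions.Kminus a b / n * √(Real.log (1 / δ))
          ≤ WeakInteractions.stdDev P X f}) := by
  have : Nonempty Ω := nonempty_of_isProbabilityMeasure P
  have hS : Nonempty S := this.map (X 0)
  have hn1 : 1 ≤ n := by omega
  have hn' : (0 : ℝ) < n := by exact_mod_cast hn1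
  have h1 := hab.firstDiffLE hf.2
  have h2 := hab.secondDiffLE (by omega) hf.2
  obtain ⟨s₀⟩ := hS
  have ha : 0 ≤ a := by
    have h := h1 ⟨0, by omega⟩ s₀ s₀ (fun _ => s₀)
    simp only [WeakInteractions.partialDiff, sub_self] at h
    exact not_lt.1 fun hlt => absurd h (not_le.2 (div_neg_of_neg_of_pos hlt hn'))
  -- Two distinct coordinates are needed for a second difference; this is where `2 ≤ n` enters.
  have hb : 0 ≤ b := by
    have h := h2 ⟨0, by omega⟩ ⟨1, by omega⟩ (by simp) s₀ s₀ s₀ s₀ (fun _ => s₀)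
    simp only [WeakInteractions.partialDiff, sub_self] at h
    exact not_lt.1 fun hlt => absurd h (not_le.2 (div_neg_of_neg_of_pos hlt (by positivity)))
  set ν := P.map (X 0) with hν
  have hνp : IsProbabilityMeasure ν := Measure.isProbabilityMeasure_map (hX 0).aemeasurable
  have hmap : ∀ i, P.map (X i) = ν := fun i => (hident i 0).map_eq
  have hXm : Measurable (fun ω i => X i ω) := measurable_pi_lambda _ hX
  have hmapX : P.map (fun ω i => X i ω) = Measure.pi fun _ : Fin (n + 1) => ν := by
    rw [(iIndepFun_iff_map_fun_eq_pi_map fun i => (hX i).aemeasurable).1 hindep]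
    simp only [hmap]
  have hYm : Measurable (fun ω (i : Fin n) => X i.castSucc ω) :=
    measurable_pi_lambda _ fun i => hX _
  have hmapY : P.map (fun ω (i : Fin n) => X i.castSucc ω) = Measure.pi fun _ : Fin n => ν := by
    rw [(iIndepFun_iff_map_fun_eq_pi_map fun i => (hX _).aemeasurable).1
      (hindep.precomp (Fin.castSucc_injective n))]
    simp only [hmap]
  have hvar : variance (fun ω => f (fun i : Fin n => X i.castSucc ω)) P
      = variance f (Measure.pi fun _ : Fin n => ν) := by
    rw [← hmapY, variance_map hf.1.aemeasurable hYm.aemeasurable]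
    rfl
  set u := √(∫ x, WeakInteractions.varEstimator f x ∂Measure.pi (fun _ => ν)) with hu
  set σ := WeakInteractions.stdDev P X f with hσ
  have hσu : σ ≤ u := by
    rw [hσ, hu, WeakInteractions.stdDev, hvar]
    exact Real.sqrt_le_sqrt (WeakInteractions.variance_le_integral_varEstimator hf)
  -- The bias `b² / (8 n²)` is at most `(b / (2 n))² L` exactly when `L ≥ 1 / 2` (for `b ≠ 0`). This
  -- holds for `ln (2 / δ) ≥ ln 2`, and for `ln (1 / δ)` once `δ ≤ 1 / e`.
  have huσ : ∀ L : ℝ, 1 / 2 ≤ L →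
      u + WeakInteractions.Kplus a b / n * √L ≤ σ + WeakInteractions.Kminus a b / n * √L := by
    intro L hL
    have h : u ≤ σ + b / 2 / n * √L := by
      have hσ0 : 0 ≤ σ := Real.sqrt_nonneg _
      have hβ : 0 ≤ b / 2 / n * √L := by positivity
      refine Real.sqrt_le_iff.2 ⟨by positivity, ?_⟩
      refine (WeakInteractions.integral_varEstimator_le hf hn1 h2).trans ?_
      rw [← hvar]
      have hσ2 : σ ^ 2 = variance (fun ω => f (fun i : Fin n => X i.castSucc ω)) P :=
        Real.sq_sqrt (variance_nonneg _ _)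
      have hβ2 : b ^ 2 / (8 * (n : ℝ) ^ 2) ≤ (b / 2 / n * √L) ^ 2 := by
        rw [mul_pow, Real.sq_sqrt (by linarith)]
        have h := mul_le_mul_of_nonneg_left hL (by positivity : 0 ≤ (b / 2 / (n : ℝ)) ^ 2)
        refine le_trans (le_of_eq ?_) h
        field_simp
        norm_num
      rw [← hσ2]
      nlinarith [mul_nonneg hσ0 hβ]
    have e : WeakInteractions.Kminus a b / n * √L
        = b / 2 / n * √L + WeakInteractions.Kplus a b / n * √L := by
      unfold WeakInteractions.Kminus WeakInteractions.Kplus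
      ring
    rw [e]
    linarith
  have hmv : Measurable fun x : Fin (n + 1) → S => √(WeakInteractions.varEstimator f x) :=
    hf.varEstimator.1.sqrt
  have hlow : ∀ L : ℝ, 0 ≤ L → P.real {ω | √(WeakInteractions.varEstimator f (fun i => X i ω))
      < u - WeakInteractions.Kplus a b / n * √L} ≤ Real.exp (-L) := by
    intro L hL
    have h := (WeakInteractions.sqrt_varEstimator_deviation (ν := ν) hf hn1 ha hb h1 h2 hL).1
    rw [← hmapX, map_measureReal_apply hXm (measurableSet_lt hmv measurable_const), hmapX] at h
    exact h
  have hupp : ∀ L : ℝ, 0 ≤ L → P.real {ω | u + WeakInteractions.Kplus a b / n * √L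
      < √(WeakInteractions.varEstimator f (fun i => X i ω))} ≤ Real.exp (-L) := by
    intro L hL
    have h := (WeakInteractions.sqrt_varEstimator_deviation (ν := ν) hf hn1 ha hb h1 h2 hL).2
    rw [← hmapX, map_measureReal_apply hXm (measurableSet_lt measurable_const hmv), hmapX] at h
    exact h
  have hexp1 : Real.exp (-Real.log (1 / δ)) = δ := by
    rw [one_div, Real.log_inv, neg_neg, Real.exp_log hδ0]
  have hexp2 : Real.exp (-Real.log (2 / δ)) = δ / 2 := by
    rw [← Real.log_inv, inv_div, Real.exp_log (by positivity)]
  have hL1 : 0 ≤ Real.log (1 / δ) := Real.log_nonneg (by rw [le_div_iff₀ hδ0]; linarith)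
  have hL2 : 1 / 2 ≤ Real.log (2 / δ) := by
    have h : Real.log 2 ≤ Real.log (2 / δ) :=
      Real.log_le_log (by norm_num) (by rw [le_div_iff₀ hδ0]; linarith)
    linarith [Real.log_two_gt_d9]
  refine ⟨?_, ?_, fun hδe => ?_⟩
  · refine WeakInteractions.one_sub_le_of_compl_subset
      (B := {ω | √(WeakInteractions.varEstimator f (fun i => X i ω))
        < u - WeakInteractions.Kplus a b / n * √(Real.log (2 / δ))} ∪
        {ω | u + WeakInteractions.Kplus a b / n * √(Real.log (2 / δ))
        < √(WeakInteractions.varEstimator f (fun i => X i ω))}) (fun ω hω => ?_) ?_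
    · by_contra h
      simp only [Set.mem_union, Set.mem_ofPred_eq, not_or, not_lt] at h
      have h3 := huσ _ hL2
      exact hω ⟨by linarith [h.2], by linarith [h.1]⟩
    · refine (measureReal_union_le _ _).trans ?_
      have h3 := hlow _ (by linarith : 0 ≤ Real.log (2 / δ))
      have h4 := hupp _ (by linarith : 0 ≤ Real.log (2 / δ))
      rw [hexp2] at h3 h4
      linarith
  · refine WeakInteractions.one_sub_le_of_compl_subset (fun ω hω => ?_)
      ((hlow _ hL1).trans_eq hexp1)
    simp only [Set.mem_compl_iff, Set.mem_ofPred_eq, not_le] at hω ⊢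
    linarith
  · have hL3 : 1 ≤ Real.log (1 / δ) := by
      rw [one_div, Real.log_inv]
      have := Real.log_le_log hδ0 hδe
      rw [Real.log_exp] at this
      linarith
    refine WeakInteractions.one_sub_le_of_compl_subset (fun ω hω => ?_)
      ((hupp _ hL1).trans_eq hexp1)
    simp only [Set.mem_compl_iff, Set.mem_ofPred_eq, not_le] at hω ⊢
    have h3 := huσ _ (by linarith : 1 / 2 ≤ Real.log (1 / δ))
    linarith
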